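/- There are absolute constants $C, C'>0$ such that the following holds. Let $k\ge 2$ be an integer, $0<\rho<1$, and let $\mu_0,\mu_1,\dots,\mu_k$ be probability distributions on the same measurable space $\Omega$ such that $\{\mu_1,\dots,\mu_k\}$ is a $\rho$-centered family around $\mu_0$, that is, $(1-\rho)\mu_0(E)\le \mu_i(E)\le (1+\rho)\mu_0(E)$ for every event $E$ and every $1\le i\le k$. Let $m,n\ge 1$ be integers and write $\frac{\mu_i(A)}{\mu_0(A)}$ for the likelihood ratio $\frac{d\mu_i}{d\mu_0}(A)$. Consider the condition \[ \sum_{S\subseteq\{1,\dots,k\},\ |S|\ge 2} n^{-|S|/2}\rho^{-|S|}\left|\mathbb{E}_{A\sim\mu_0}\prod_{i\in S}\left(\frac{\mu_i(A)}{\mu_0(A)}-1\right)\right|\le \frac1n .\tag{1} \] (a) If $\rho\le (n\ln k)^{-1/2}/C'$ and (1) holds, then every $(m,n)$-protocol identifying $\mu\in\{\mu_1,\dots,\mu_k\}$ with error $1/3$ has communication complexity at least \[ \frac{k}{C\rho^2 n\log\left(k/(n\rho^2)\right)} . \] (b) Condition (1) holds whenever there is an integer $\ell\ge 2$ such that all terms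 of the sum in (1) with $2\le |S|\le \ell$ vanish and $n\ge k^{2(\ell+1)/(\ell-1)}$. Here an $(m,n)$-protocol identifying $\mu\in\{\mu_1,\dots,\mu_k\}$ with error $\varepsilon$ is a randomized $m$-party protocol in which each party's input is a tuple of $n$ points of $\Omega$ and the parties communicate by broadcasting bits: the history of bits sent so far (and the randomness) determines which party sends the next bit, or that the protocol halts; each bit sent is a function of the sender's own input, the history and the randomness; and upon halting an index in $\{1,\dots,k\}$ is output as a function of the history and the randomness. The randomness is a seed independent of the inputs, which may be shared by all parties (private randomness being a special case). It is required that for every $i$, if all $mn$ input points are drawn independently from $\mu_i$, the protocol halts and outputs $i$ with probability at least $1-\varepsilon$. Its communication complexity is the maximal total number of bits sent, over all inputs and all values of the randomness. -/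

import Mathlib

open MeasureTheory
open scoped ENNReal

noncomputable section

/-- `μ 0, …, μ (k-1)` is a `ρ`-centered family of distributions, centered around `μ₀`. -/
structure IsCenteredFamily {Ω : Type*} [MeasurableSpace Ω] {k : ℕ} (ρ : ℝ)
    (μ₀ : Measure Ω) (μ : Fin k → Measure Ω) : Prop where
  rho_pos : 0 < ρ
  rho_lt_one : ρ < 1
  two_le : 2 ≤ k
  prob_center : IsProbabilityMeasure μ₀
  prob : ∀ i, IsProbabilityMeasure (μ i)
  lower : ∀ i (E : Set Ω), MeasurableSet E → (1 - ρ) * μ₀.real E ≤ (μ i).real E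
  upper : ∀ i (E : Set Ω), MeasurableSet E → (μ i).real E ≤ (1 + ρ) * μ₀.real E

/-- The term `n^{-|S|/2} ρ^{-|S|} |E_{A ∼ μ₀} ∏_{i ∈ S} (μ_i(A)/μ₀(A) - 1)|`, where the likelihood
ratio `μ_i(A)/μ₀(A)` is the Radon–Nikodym derivative. -/
def corrTerm {Ω : Type*} [MeasurableSpace Ω] {k : ℕ} (n : ℕ) (ρ : ℝ)
    (μ₀ : Measure Ω) (μ : Fin k → Measure Ω) (S : Finset (Fin k)) : ℝ :=
  (n : ℝ) ^ (-(S.card : ℝ) / 2) * ρ ^ (-(S.card : ℝ)) *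
    |∫ a, ∏ i ∈ S, (((μ i).rnDeriv μ₀ a).toReal - 1) ∂μ₀|

/-- The weighted correlations of order at least two sum to at most `1/n`. -/
def CorrCondition {Ω : Type*} [MeasurableSpace Ω] {k : ℕ} (n : ℕ) (ρ : ℝ)
    (μ₀ : Measure Ω) (μ : Fin k → Measure Ω) : Prop :=
  ∑ S : Finset (Fin k) with 2 ≤ S.card, corrTerm n ρ μ₀ μ S ≤ 1 / (n : ℝ)

/-- A randomized `m`-party broadcast protocol in which every party holds an input from `X` and which
outputs an element of `Fin k`.

Messages are broadcast bit by bit, and the history is the list of all bits sent so far; a longer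
message is a run of consecutive bits of one party. Given the history, `next` says which party
sends the next bit (`none`: the protocol halts); that bit depends on the speaker's own input, the
randomness and the history. There is no bound on the number of rounds.

The random seed `r : R` is common to all parties. Private coins are the special case in which `r`
is a tuple of independent seeds of which party `j` uses only the `j`-th one. -/
structure Protocol (m k : ℕ) (X R : Type*) [MeasurableSpace X] [MeasurableSpace R] where
  coins : Measure R
  prob_coins : IsProbabilityMeasure coins
  next : R → List Bool → Option (Fin m)
  bit : Fin m → X → R → List Bool → Bool
  output : R → List Bool → Fin k
  measurableSet_next : ∀ h o, MeasurableSet {r | next r h = o}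
  measurable_bit : ∀ j h, Measurable fun p : X × R => bit j p.1 p.2 h
  measurableSet_output : ∀ h i, MeasurableSet {r | output r h = i}

namespace Protocol

variable {m k : ℕ} {X R : Type*} [MeasurableSpace X] [MeasurableSpace R]

/-- The history after (at most) `t` bits, on seed `r` and inputs `x`. -/
def history (π : Protocol m k X R) (r : R) (x : Fin m → X) : ℕ → List Bool
  | 0 => []
  | t + 1 =>
    match π.next r (π.history r x t) with
    | none => π.history r x t
    | some j => π.history r x t ++ [π.bit j (x j) r (π.history r x t)]

/-- On seed `r` and inputs `x` the protocol halts and outputs `i`. -/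
def Outputs (π : Protocol m k X R) (r : R) (x : Fin m → X) (i : Fin k) : Prop :=
  ∃ t, π.next r (π.history r x t) = none ∧ π.output r (π.history r x t) = i

/-- The maximal number of bits sent, over all inputs and all seeds (`⊤` if unbounded). -/
def communicationComplexity (π : Protocol m k X R) : ℕ∞ :=
  ⨆ (r : R) (x : Fin m → X) (t : ℕ), ((π.history r x t).length : ℕ∞)

/-- `π` is an `(m,n)`-protocol identifying `μ ∈ {μ 0, …, μ (k-1)}` with error `ε`: if each of the
`m` parties receives `n` independent samples from `μ i`, the output is `i` with probability at
least `1 - ε`, for every `i`. -/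
def Identifies {Ω : Type*} [MeasurableSpace Ω] {n : ℕ} (π : Protocol m k (Fin n → Ω) R)
    (μ : Fin k → Measure Ω) (ε : ℝ) : Prop :=
  ∀ i, 1 - ε ≤
    (π.coins.prod (Measure.pi fun _ : Fin m => Measure.pi fun _ : Fin n => μ i)).real
      {p | π.Outputs p.1 p.2 i}

end Protocol

end

/-! Write ε = √n ρ and F_i = dμ_i/dμ₀ − 1. Let H_i(x) = ∏_t (1 + F_i(x_t)) be the likelihood ratio
of one party's n samples, and Y_i = (H_i − 1)/ε. The point is that one party's message cannot be
informative about many i at once.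

This is the level-one inequality `sum_sq_average_le`: if E has probability p under μ₀^n and |Y_i| ≤
L on E, then Σ_i E[Y_i | E]² = O(L² (1 + log(1/p))). It would follow by Jensen from a bound on the
expectation of exp(Σ c_i Y_i), but powers of Y_i contain F_i(x_t)², while (1) only controls products
over distinct i. So the exponential is replaced by a product of `tiltWeight`s: nonnegative,
dominating it up to a harmless factor where |c_i Y_i| ≤ 1, and multilinear in the F_i(x_t). Its
expectation factors over the independent samples; each contributes at most Σ_T ε^(−|T|) |E ∏_{i∈T}
F_i| ≤ 1 + 1/n, and (1 + 1/n)^n ≤ e.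

For a fixed seed, the transcripts of a B-bit protocol partition the inputs into rectangles
restricting at most B parties. By `one_sub_le_affinity`, the Hellinger affinity of the transcript
laws under μ₀ and μ_i is at least 1 minus the mean sum of squared relative deviations of the sides.
Summed over i, the level-one inequality bounds these deviations by O(ε² L²) times B plus the entropy
of the transcript, so by O(ε² L² B). If B is far below k/(ε² L²), the average law is close to that
under μ₀, where the k success probabilities sum to 1, and they cannot reach a total of 2k/3.

The bound |Y_i| ≤ L is enforced by conditioning every party's input on a typical set; Hoeffding's
inequality allows L² of order log(k/ε²), which is the logarithm in the result. -/

/-! ### Nonnegative weights comparable to `exp (c Y)` -/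

/-- With `Y = (∏ (1 + f t) - 1) / ε`, this is `1 + c Y + 2 c² R`, where `R` is a multilinear
surrogate of `Y²`. -/
noncomputable def tiltWeight {n : ℕ} (ε c : ℝ) (f : Fin n → ℝ) : ℝ :=
  1 + c / ε * (∏ t, (1 + f t) - 1)
    + 2 * (c / ε) ^ 2 * (∏ t, (1 + 2 * f t) - 2 * ∏ t, (1 + f t) + 1)

/-- The coefficient of the monomials of degree `d` in `tiltWeight`. -/
noncomputable def tiltCoeff (ε c : ℝ) (d : ℕ) : ℝ :=
  if d = 0 then 1 else c / ε + 2 * (c / ε) ^ 2 * (2 ^ d - 2)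

/-- Both products expand over subsets. The constant terms combine to 1, and in degree 1 the
surrogate of the square drops out because 2^1 − 2 = 0. -/
theorem tiltWeight_eq_sum {n : ℕ} (ε c : ℝ) (f : Fin n → ℝ) :
    tiltWeight ε c f = ∑ A : Finset (Fin n), tiltCoeff ε c A.card * ∏ t ∈ A, f t := by
  have h1 : ∏ t, (1 + f t) = ∑ A : Finset (Fin n), ∏ t ∈ A, f t := by
    rw [Finset.prod_one_add, Finset.powerset_univ]
  have h2 : ∏ t, (1 + 2 * f t) = ∑ A : Finset (Fin n), 2 ^ A.card * ∏ t ∈ A, f t := by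
    rw [Finset.prod_one_add, Finset.powerset_univ]
    simp [Finset.prod_mul_distrib]
  have h3 : ∀ A : Finset (Fin n), tiltCoeff ε c A.card * ∏ t ∈ A, f t =
      (if A = ∅ then (1 - c / ε + 2 * (c / ε) ^ 2) else 0) + c / ε * ∏ t ∈ A, f t
      + 2 * (c / ε) ^ 2 * (2 ^ A.card * ∏ t ∈ A, f t - 2 * ∏ t ∈ A, f t) := by
    intro A
    by_cases hA : A = ∅
    · subst hA; simp [tiltCoeff]; ring
    · simp only [tiltCoeff, Finset.card_eq_zero, hA, if_false]; ring
  simp_rw [h3]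
  rw [tiltWeight, h1, h2, Finset.sum_add_distrib, Finset.sum_add_distrib, ← Finset.mul_sum,
    ← Finset.mul_sum, Finset.sum_sub_distrib, ← Finset.mul_sum]
  simp only [Finset.sum_ite_eq', Finset.mem_univ, if_true]
  ring

/-- The bound matches the weights ε^(−|T|) of the correlation sum. Degree 1 only has c/ε; from
degree 2 on a factor ε^(−2) is affordable, and 2^d is absorbed by the remaining powers of ε since 2ε
≤ 1. -/
theorem abs_tiltCoeff_le {ε c : ℝ} (hε : 0 < ε) (hε' : ε ≤ 1 / 4) (hc : |c| ≤ 1 / 16) (d : ℕ) :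
    |tiltCoeff ε c d| ≤ (ε ^ d)⁻¹ := by
  rcases d with _ | _ | d
  · simp [tiltCoeff]
  · have : tiltCoeff ε c (0 + 1) = c / ε := by simp [tiltCoeff]
    rw [this, abs_div, abs_of_pos hε, zero_add, pow_one, div_eq_mul_inv]
    have : 0 < ε⁻¹ := by positivity
    nlinarith
  · have h0 : tiltCoeff ε c (d + 1 + 1) = c / ε + 2 * (c / ε) ^ 2 * (2 ^ (d + 2) - 2) := by
      simp [tiltCoeff]
    rw [h0, ← one_div, le_div_iff₀ (by positivity)]
    have h2 : (2 : ℝ) ≤ 2 ^ (d + 2) := by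
      calc (2 : ℝ) = 2 ^ 1 := by norm_num
        _ ≤ 2 ^ (d + 2) := pow_le_pow_right₀ (by norm_num) (by omega)
    have h3 : |c / ε + 2 * (c / ε) ^ 2 * (2 ^ (d + 2) - 2)| ≤
        |c| / ε + 2 * (c / ε) ^ 2 * 2 ^ (d + 2) := by
      refine (abs_add_le _ _).trans ?_
      rw [abs_div, abs_of_pos hε, abs_of_nonneg (a := 2 * (c / ε) ^ 2 * (2 ^ (d + 2) - 2))
        (mul_nonneg (by positivity) (by linarith))]
      have : 0 ≤ 2 * (c / ε) ^ 2 := by positivity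
      nlinarith
    have hc2 : c ^ 2 ≤ 1 / 256 := by have := abs_le.1 hc; nlinarith
    have h4 : ε ^ d ≤ 1 := pow_le_one₀ hε.le (by linarith)
    have h5 : (2 * ε) ^ d ≤ 1 := pow_le_one₀ (by linarith) (by linarith)
    calc _ ≤ (|c| / ε + 2 * (c / ε) ^ 2 * 2 ^ (d + 2)) * ε ^ (d + 1 + 1) :=
          mul_le_mul_of_nonneg_right h3 (by positivity)
      _ = |c| * ε * ε ^ d + 8 * c ^ 2 * (2 * ε) ^ d := by
          rw [mul_pow]; field_simp; ring
      _ ≤ |c| * ε * 1 + 8 * c ^ 2 * 1 := by gcongr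
      _ ≤ 1 := by nlinarith [abs_nonneg c]

/-- Factorwise, f² ≤ ρ² ≤ 2ρ²(1 + 2f) because 1 + 2f ≥ 1/2. Thus ∏ (1 + 2f) can stand in for the
square of the likelihood ratio. -/
theorem sq_prod_le {n : ℕ} {ρ ε : ℝ} (f : Fin n → ℝ) (hf : ∀ t, |f t| ≤ ρ) (hρ : ρ ≤ 1 / 4)
    (hε : (n : ℝ) * ρ ^ 2 = ε ^ 2) (hε' : ε ^ 2 ≤ 1 / 16) :
    (∏ t, (1 + f t)) ^ 2 ≤ (1 + 4 * ε ^ 2) * ∏ t, (1 + 2 * f t) := by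
  have hpos : ∀ t, 0 ≤ 1 + 2 * f t := fun t => by
    have := abs_le.1 (hf t); linarith
  have h1 : (∏ t, (1 + f t)) ^ 2 ≤ ∏ t : Fin n, ((1 + 2 * ρ ^ 2) * (1 + 2 * f t)) := by
    rw [← Finset.prod_pow]
    refine Finset.prod_le_prod (fun t _ => sq_nonneg _) fun t _ => ?_
    have h := abs_le.1 (hf t)
    have h2 : f t ^ 2 ≤ ρ ^ 2 := sq_le_sq' h.1 h.2
    nlinarith [sq_nonneg ρ]
  refine h1.trans ?_
  rw [Finset.prod_mul_distrib]
  refine mul_le_mul_of_nonneg_right ?_ (Finset.prod_nonneg fun t _ => hpos t)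
  rw [Finset.prod_const, Finset.card_univ, Fintype.card_fin]
  calc (1 + 2 * ρ ^ 2) ^ n ≤ (Real.exp (2 * ρ ^ 2)) ^ n := by
        refine pow_le_pow_left₀ (by positivity) ?_ n
        linarith [Real.add_one_le_exp (2 * ρ ^ 2)]
    _ = Real.exp (2 * ε ^ 2) := by rw [← Real.exp_nat_mul, ← hε]; ring_nf
    _ ≤ 1 + 4 * ε ^ 2 := by
        have h := Real.abs_exp_sub_one_sub_id_le (x := 2 * ε ^ 2)
          (by rw [abs_of_nonneg (by positivity)]; linarith)
        have := (abs_le.1 h).2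
        nlinarith [sq_nonneg ε]

/-- The surrogate of Y² is at least Y²/2 − 8; the factor 2 in `tiltWeight` compensates for the half.
-/
theorem le_tiltWeight {n : ℕ} {ρ ε c Y : ℝ} (f : Fin n → ℝ) (hf : ∀ t, |f t| ≤ ρ)
    (hρ : ρ ≤ 1 / 4) (hε0 : 0 < ε) (hε : (n : ℝ) * ρ ^ 2 = ε ^ 2) (hε' : ε ≤ 1 / 4)
    (hY : ∏ t, (1 + f t) = 1 + ε * Y) :
    1 + c * Y + (c * Y) ^ 2 - 16 * c ^ 2 ≤ tiltWeight ε c f := by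
  have hε2 : ε ^ 2 ≤ 1 / 16 := by nlinarith
  have h := sq_prod_le f hf hρ hε hε2
  rw [hY] at h
  have hw : tiltWeight ε c f = 1 + c * Y +
      2 * (c / ε) ^ 2 * (∏ t, (1 + 2 * f t) - 2 * (1 + ε * Y) + 1) := by
    rw [tiltWeight, hY]; field_simp; ring
  set H := ∏ t, (1 + 2 * f t)
  have hH : (1 - 4 * ε ^ 2) * (1 + ε * Y) ^ 2 ≤ H := by
    have h0 : 0 ≤ 1 - 4 * ε ^ 2 := by linarith
    have hHn : 0 ≤ H := by
      by_contra hneg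
      nlinarith [sq_nonneg (1 + ε * Y), sq_nonneg ε]
    have := mul_le_mul_of_nonneg_left h h0
    nlinarith [mul_nonneg (sq_nonneg (ε ^ 2)) hHn]
  have hR : ε ^ 2 * (Y ^ 2 / 2 - 8) ≤ H - 2 * (1 + ε * Y) + 1 := by
    have : (1 + ε * Y) ^ 2 ≤ 2 + 2 * (ε * Y) ^ 2 := by nlinarith [sq_nonneg (1 - ε * Y)]
    nlinarith [sq_nonneg (ε * Y), sq_nonneg ε, mul_nonneg (sq_nonneg ε) (sq_nonneg (ε * Y))]
  have := mul_le_mul_of_nonneg_left hR (by positivity : 0 ≤ 2 * (c / ε) ^ 2)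
  rw [hw]
  have e : 2 * (c / ε) ^ 2 * (ε ^ 2 * (Y ^ 2 / 2 - 8)) = (c * Y) ^ 2 - 16 * c ^ 2 := by
    field_simp; ring
  linarith

theorem tiltWeight_nonneg {n : ℕ} {ρ ε c : ℝ} (f : Fin n → ℝ) (hf : ∀ t, |f t| ≤ ρ)
    (hρ : ρ ≤ 1 / 4) (hε0 : 0 < ε) (hε : (n : ℝ) * ρ ^ 2 = ε ^ 2) (hε' : ε ≤ 1 / 4)
    (hc : |c| ≤ 1 / 16) : 0 ≤ tiltWeight ε c f := by
  have h := le_tiltWeight (c := c) (Y := (∏ t, (1 + f t) - 1) / ε) f hf hρ hε0 hε hε'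
    (by field_simp; ring)
  have := abs_le.1 hc
  nlinarith [sq_nonneg (c * ((∏ t, (1 + f t) - 1) / ε) + 1 / 2)]

/-- For |u| ≤ 1 one has exp u ≤ 1 + u + u². The loss 16c² becomes the factor exp(−96c²) because
exp(cY) ≥ 1/3. -/
theorem exp_le_tiltWeight {n : ℕ} {ρ ε c Y : ℝ} (f : Fin n → ℝ) (hf : ∀ t, |f t| ≤ ρ)
    (hρ : ρ ≤ 1 / 4) (hε0 : 0 < ε) (hε : (n : ℝ) * ρ ^ 2 = ε ^ 2) (hε' : ε ≤ 1 / 4)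
    (hY : ∏ t, (1 + f t) = 1 + ε * Y) (hc : |c| ≤ 1 / 16) (hcY : |c * Y| ≤ 1) :
    Real.exp (c * Y - 96 * c ^ 2) ≤ tiltWeight ε c f := by
  refine le_trans ?_ (le_tiltWeight (c := c) f hf hρ hε0 hε hε' hY)
  have h1 := (abs_le.1 (Real.abs_exp_sub_one_sub_id_le hcY)).2
  have hc2 : c ^ 2 ≤ 1 / 256 := by have := abs_le.1 hc; nlinarith
  have h2 : Real.exp (-(96 * c ^ 2)) ≤ 1 - 48 * c ^ 2 := by
    rw [Real.exp_neg, inv_le_comm₀ (Real.exp_pos _) (by linarith)]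
    refine le_trans ?_ (Real.add_one_le_exp _)
    rw [inv_le_iff_one_le_mul₀ (by linarith)]
    nlinarith [sq_nonneg c]
  have h3 : 1 / 3 ≤ Real.exp (c * Y) := by
    have h4 : Real.exp (-1) ≤ Real.exp (c * Y) := Real.exp_le_exp.2 (abs_le.1 hcY).1
    refine le_trans ?_ h4
    rw [Real.exp_neg, one_div]
    exact inv_anti₀ (Real.exp_pos _) (by linarith [Real.exp_one_lt_d9])
  rw [sub_eq_add_neg, Real.exp_add]
  have := mul_le_mul_of_nonneg_left h2 (Real.exp_pos (c * Y)).le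
  nlinarith [sq_nonneg c]

/-! ### The weights have a bounded joint expectation -/

/-- Transposition of a family of sets. -/
def transposeEquiv (k n : ℕ) : (Fin k → Finset (Fin n)) ≃ (Fin n → Finset (Fin k)) where
  toFun A t := {i | t ∈ A i}
  invFun T i := {t | i ∈ T t}
  left_inv A := by ext; simp
  right_inv T := by ext; simp

theorem prod_prod_transposeEquiv {k n : ℕ} {α : Type*} [CommMonoid α]
    (A : Fin k → Finset (Fin n)) (g : Fin k → Fin n → α) :
    ∏ i, ∏ t ∈ A i, g i t = ∏ t, ∏ i ∈ transposeEquiv k n A t, g i t := by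
  have h1 : ∀ i, ∏ t ∈ A i, g i t = ∏ t, if t ∈ A i then g i t else 1 := fun i => by
    rw [Finset.prod_ite_mem, Finset.univ_inter]
  have h2 : ∀ t, ∏ i ∈ transposeEquiv k n A t, g i t = ∏ i, if t ∈ A i then g i t else 1 :=
    fun t => by simp [transposeEquiv, Finset.prod_filter]
  simp_rw [h1, h2]
  exact Finset.prod_comm

theorem integrable_and_integral_prod_tiltWeight_le {Ω : Type*} [MeasurableSpace Ω] {k n : ℕ}
    (hn : 1 ≤ n)
    (μ₀ : Measure Ω) [IsProbabilityMeasure μ₀] {ρ ε : ℝ} (F : Fin k → Ω → ℝ)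
    (hFm : ∀ i, Measurable (F i)) (hF : ∀ i a, |F i a| ≤ ρ) (hε0 : 0 < ε) (hε' : ε ≤ 1 / 4)
    (hcorr : ∑ T : Finset (Fin k), (ε ^ T.card)⁻¹ * |∫ a, ∏ i ∈ T, F i a ∂μ₀| ≤ 1 + 1 / n)
    (c : Fin k → ℝ) (hc : ∀ i, |c i| ≤ 1 / 16) :
    Integrable (fun x : Fin n → Ω => ∏ i, tiltWeight ε (c i) fun t => F i (x t))
      (Measure.pi fun _ : Fin n => μ₀) ∧
    ∫ x, ∏ i, tiltWeight ε (c i) (fun t => F i (x t)) ∂(Measure.pi fun _ : Fin n => μ₀)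
      ≤ Real.exp 1 := by
  have hint : ∀ T : Finset (Fin k), Integrable (fun a => ∏ i ∈ T, F i a) μ₀ := fun T => by
    refine Integrable.of_bound (C := ρ ^ T.card) ?_ (ae_of_all _ fun a => ?_)
    · exact (Finset.measurable_fun_prod T fun i _ => hFm i).aestronglyMeasurable
    · rw [Real.norm_eq_abs, Finset.abs_prod]
      rw [← Finset.prod_const]
      exact Finset.prod_le_prod (fun _ _ => abs_nonneg _) fun i _ => hF i a
  have hexp : ∀ x : Fin n → Ω, ∏ i, tiltWeight ε (c i) (fun t => F i (x t)) =
      ∑ A : Fin k → Finset (Fin n), (∏ i, tiltCoeff ε (c i) (A i).card) *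
        ∏ t, ∏ i ∈ transposeEquiv k n A t, F i (x t) := fun x => by
    simp_rw [tiltWeight_eq_sum]
    rw [Finset.prod_univ_sum, Fintype.piFinset_univ]
    refine Finset.sum_congr rfl fun A _ => ?_
    rw [Finset.prod_mul_distrib, prod_prod_transposeEquiv A fun i t => F i (x t)]
  simp_rw [hexp]
  have hintA : ∀ A : Fin k → Finset (Fin n), Integrable (fun x : Fin n → Ω =>
      (∏ i, tiltCoeff ε (c i) (A i).card) * ∏ t, ∏ i ∈ transposeEquiv k n A t, F i (x t))
      (Measure.pi fun _ : Fin n => μ₀) := fun A =>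
    (Integrable.fintype_prod fun t => hint (transposeEquiv k n A t)).const_mul _
  refine ⟨integrable_finsetSum _ fun A _ => hintA A, ?_⟩
  rw [integral_finsetSum _ fun A _ => hintA A]
  have hterm : ∀ A : Fin k → Finset (Fin n),
      ∫ x, (∏ i, tiltCoeff ε (c i) (A i).card) * ∏ t, ∏ i ∈ transposeEquiv k n A t, F i (x t)
        ∂(Measure.pi fun _ : Fin n => μ₀) ≤
      ∏ t, ((ε ^ (transposeEquiv k n A t).card)⁻¹ *
        |∫ a, ∏ i ∈ transposeEquiv k n A t, F i a ∂μ₀|) := fun A => by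
    rw [integral_const_mul, integral_fintype_prod_eq_prod
      (f := fun t a => ∏ i ∈ transposeEquiv k n A t, F i a)]
    refine (le_abs_self _).trans ?_
    rw [abs_mul, Finset.abs_prod, Finset.abs_prod, Finset.prod_mul_distrib]
    refine mul_le_mul_of_nonneg_right ?_ (Finset.prod_nonneg fun _ _ => abs_nonneg _)
    calc ∏ i, |tiltCoeff ε (c i) (A i).card| ≤ ∏ i, (ε ^ (A i).card)⁻¹ :=
          Finset.prod_le_prod (fun _ _ => abs_nonneg _)
            fun i _ => abs_tiltCoeff_le hε0 hε' (hc i) _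
      _ = ∏ i, ∏ t ∈ A i, ε⁻¹ := by simp
      _ = _ := by rw [prod_prod_transposeEquiv A fun _ _ => ε⁻¹]; simp
  refine (Finset.sum_le_sum fun A _ => hterm A).trans ?_
  -- Indexed by the set of hypotheses that use each sample, the sum over all families factors into n
  -- equal sums, one per sample.
  rw [(transposeEquiv k n).sum_comp fun T : Fin n → Finset (Fin k) =>
    ∏ t, ((ε ^ (T t).card)⁻¹ * |∫ a, ∏ i ∈ T t, F i a ∂μ₀|)]
  rw [← Fintype.piFinset_univ, ← Finset.prod_univ_sum (fun _ : Fin n => Finset.univ)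
    fun _ T => (ε ^ T.card)⁻¹ * |∫ a, ∏ i ∈ T, F i a ∂μ₀|, Finset.prod_const, Finset.card_univ,
    Fintype.card_fin]
  have hn0 : (0 : ℝ) < n := by exact_mod_cast hn
  calc _ ≤ (1 + 1 / (n : ℝ)) ^ n := pow_le_pow_left₀
        (Finset.sum_nonneg fun T _ => by positivity) hcorr n
    _ ≤ (Real.exp (1 / n)) ^ n := pow_le_pow_left₀ (by positivity)
        (by linarith [Real.add_one_le_exp (1 / (n : ℝ))]) n
    _ = Real.exp 1 := by rw [← Real.exp_nat_mul]; congr 1; field_simp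

/-! ### A level-one inequality -/

/-- If suitable nonnegative weights dominate `exp (∑ c i * Y i)`, then conditioning on an event of
probability `p` moves the means of the `Y i` by at most `O(L² (log (1/p) + 1))` in total squared
distance. -/
theorem sum_sq_average_le {X : Type*} [MeasurableSpace X] (M : Measure X) [IsProbabilityMeasure M]
    {k : ℕ} (Y : Fin k → X → ℝ) (hYm : ∀ i, Measurable (Y i))
    (hW : ∀ c : Fin k → ℝ, (∀ i, |c i| ≤ 1 / 16) → ∃ w : X → ℝ, Integrable w M ∧ (∀ x, 0 ≤ w x) ∧
      ∫ x, w x ∂M ≤ Real.exp 1 ∧ ∀ x, (∀ i, |c i * Y i x| ≤ 1) →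
        Real.exp (∑ i, (c i * Y i x - 96 * c i ^ 2)) ≤ w x)
    {L : ℝ} (hL : 16 ≤ L) {E : Set X} (hE : MeasurableSet E) (hYE : ∀ i, ∀ x ∈ E, |Y i x| ≤ L)
    (hp : 0 < M.real E) :
    ∑ i, ((∫ x in E, Y i x ∂M) / M.real E) ^ 2 ≤ 2 * L ^ 2 * (1 - Real.log (M.real E)) := by
  set p := M.real E
  set y : Fin k → ℝ := fun i => (∫ x in E, Y i x ∂M) / p with hy
  have hL0 : 0 < L := by linarith
  have hYint : ∀ i, IntegrableOn (Y i) E M := fun i =>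
    IntegrableOn.of_bound (measure_lt_top _ _) (hYm i).aestronglyMeasurable L
      (ae_restrict_of_forall_mem hE fun x hx => hYE i x hx)
  have hyL : ∀ i, |y i| ≤ L := fun i => by
    have h := norm_setIntegral_le_of_norm_le_const (f := Y i) (measure_lt_top M E)
      (fun x hx => hYE i x hx)
    rw [hy, abs_div, abs_of_pos hp, div_le_iff₀ hp]
    exact h
  -- The tilt points along the conditional means; the scale 1/L² gives |c i * Y i| ≤ 1 on E and |c
  -- i| ≤ 1/L ≤ 1/16.
  set c : Fin k → ℝ := fun i => y i / L ^ 2 with hc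
  have hcL : ∀ i, |c i| ≤ 1 / L := fun i => by
    rw [hc, abs_div, abs_of_pos (by positivity : 0 < L ^ 2), div_le_div_iff₀ (by positivity) hL0]
    nlinarith [hyL i]
  obtain ⟨w, hwi, hw0, hw1, hwE⟩ := hW c fun i => (hcL i).trans
    (one_div_le_one_div_of_le (by norm_num) hL)
  set S : X → ℝ := fun x => ∑ i, (c i * Y i x - 96 * c i ^ 2) with hS
  set a : ℝ := ∑ i, (c i * y i - 96 * c i ^ 2) with ha
  have hterm : ∀ i, IntegrableOn (fun x => c i * Y i x - 96 * c i ^ 2) E M := fun i =>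
    ((hYint i).const_mul _).sub (integrable_const _)
  have hSint : IntegrableOn S E M := integrable_finsetSum _ fun i _ => hterm i
  have hSaint : IntegrableOn (fun x => S x - a) E M := hSint.sub (integrable_const _)
  have hSa : ∫ x in E, S x ∂M = p * a := by
    simp only [hS]
    rw [integral_finsetSum _ fun i _ => hterm i, ha, Finset.mul_sum]
    refine Finset.sum_congr rfl fun i _ => ?_
    rw [integral_sub ((hYint i).const_mul _) (integrable_const _), integral_const_mul,
      setIntegral_const, smul_eq_mul]
    have : ∫ x in E, Y i x ∂M = p * y i := by rw [hy]; field_simp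
    rw [this]; ring
  -- Jensen's inequality through the tangent line of exp at the conditional mean a of S.
  have hlow : p * Real.exp a ≤ Real.exp 1 := by
    calc p * Real.exp a = ∫ x in E, Real.exp a * (1 + (S x - a)) ∂M := by
          rw [integral_const_mul, integral_add (integrable_const _) hSaint,
            integral_sub hSint (integrable_const _), hSa,
            setIntegral_const, setIntegral_const, smul_eq_mul, smul_eq_mul]
          ring
      _ ≤ ∫ x in E, w x ∂M := by
          refine setIntegral_mono_on (((integrable_const _).add
            hSaint).const_mul _) hwi.integrableOn hE fun x hx => ?_
          have h1 : ∀ i, |c i * Y i x| ≤ 1 := fun i => by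
            rw [abs_mul]
            calc |c i| * |Y i x| ≤ 1 / L * L :=
                  mul_le_mul (hcL i) (hYE i x hx) (abs_nonneg _) (by positivity)
              _ = 1 := by field_simp
          refine le_trans ?_ (hwE x h1)
          have h2 := Real.add_one_le_exp (S x - a)
          calc Real.exp a * (1 + (S x - a)) ≤ Real.exp a * Real.exp (S x - a) :=
                mul_le_mul_of_nonneg_left (by linarith) (Real.exp_pos _).le
            _ = Real.exp (S x) := by rw [← Real.exp_add]; congr 1; ring
      _ ≤ ∫ x, w x ∂M := setIntegral_le_integral hwi (ae_of_all _ hw0)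
      _ ≤ Real.exp 1 := hw1
  have hlog : Real.log p + a ≤ 1 := by
    have := Real.log_le_log (by positivity) hlow
    rwa [Real.log_mul hp.ne' (Real.exp_pos _).ne', Real.log_exp, Real.log_exp] at this
  have haeq : a = (1 / L ^ 2 - 96 / L ^ 4) * ∑ i, y i ^ 2 := by
    rw [ha, Finset.mul_sum]
    refine Finset.sum_congr rfl fun i _ => ?_
    simp only [hc]; field_simp
  have hcoef : 1 / (2 * L ^ 2) ≤ 1 / L ^ 2 - 96 / L ^ 4 := by
    rw [div_sub_div _ _ (by positivity) (by positivity), div_le_div_iff₀ (by positivity)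
      (by positivity)]
    have h256 : 256 ≤ L ^ 2 := by nlinarith
    nlinarith [pow_pos hL0 4, pow_pos hL0 6, mul_le_mul_of_nonneg_left h256 (pow_pos hL0 4).le]
  have hsum : 0 ≤ ∑ i, y i ^ 2 := Finset.sum_nonneg fun i _ => sq_nonneg _
  have hfin : 1 / (2 * L ^ 2) * ∑ i, y i ^ 2 ≤ 1 - Real.log p := by
    have := mul_le_mul_of_nonneg_right hcoef hsum
    linarith
  rw [one_div, inv_mul_le_iff₀ (by positivity)] at hfin
  exact hfin

/-! ### Transcripts of a protocol -/

namespace Protocol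

variable {m k : ℕ} {X R : Type*} [MeasurableSpace X] [MeasurableSpace R]

theorem history_succ_of_none (π : Protocol m k X R) {r : R} {x : Fin m → X} {t : ℕ}
    (h : π.next r (π.history r x t) = none) : π.history r x (t + 1) = π.history r x t := by
  rw [history, h]

theorem history_succ_of_some (π : Protocol m k X R) {r : R} {x : Fin m → X} {t : ℕ} {j : Fin m}
    (h : π.next r (π.history r x t) = some j) : π.history r x (t + 1) =
      π.history r x t ++ [π.bit j (x j) r (π.history r x t)] := by
  rw [history, h]

theorem history_eq_of_halted (π : Protocol m k X R) {r : R} {x : Fin m → X} {t : ℕ}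
    (h : π.next r (π.history r x t) = none) (s : ℕ) :
    π.history r x (t + s) = π.history r x t := by
  induction s with
  | zero => rfl
  | succ s ih => rw [← add_assoc, π.history_succ_of_none (by rw [ih]; exact h), ih]

/-- Each step before halting adds exactly one bit, so a protocol limited to B bits has halted by
time B. -/
theorem length_history (π : Protocol m k X R) {r : R} {x : Fin m → X} (t : ℕ)
    (h : π.next r (π.history r x t) ≠ none) : (π.history r x (t + 1)).length = t + 1 := by
  induction t with
  | zero =>
    obtain ⟨j, hj⟩ := Option.ne_none_iff_exists'.1 h
    rw [π.history_succ_of_some hj]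
    simp [history]
  | succ t ih =>
    obtain ⟨j, hj⟩ := Option.ne_none_iff_exists'.1 h
    rw [π.history_succ_of_some hj, List.length_append, ih]
    · rfl
    · intro h0
      rw [π.history_succ_of_none h0] at h
      exact h h0

theorem outputs_iff (π : Protocol m k X R) {B : ℕ} (hB : ∀ r x t, (π.history r x t).length ≤ B)
    (r : R) (x : Fin m → X) (i : Fin k) :
    π.Outputs r x i ↔ π.output r (π.history r x B) = i := by
  have hhalt : π.next r (π.history r x B) = none := by
    by_contra h
    have := π.length_history B h
    have := hB r x (B + 1)
    omega
  constructor
  · rintro ⟨t, ht, hti⟩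
    have h1 := π.history_eq_of_halted ht B
    have h2 := π.history_eq_of_halted hhalt t
    rw [add_comm] at h2
    rw [← h2, h1, hti]
  · exact fun h => ⟨B, hhalt, h⟩

theorem measurableSet_history (π : Protocol m k X R) (t : ℕ) (h : List Bool) :
    MeasurableSet {p : R × (Fin m → X) | π.history p.1 p.2 t = h} := by
  induction t generalizing h with
  | zero => simp [history]
  | succ t ih =>
    have : {p : R × (Fin m → X) | π.history p.1 p.2 (t + 1) = h} =
        ⋃ h' : List Bool, {p | π.history p.1 p.2 t = h'} ∩
          (({p | π.next p.1 h' = none} ∩ {_p | h' = h}) ∪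
            ⋃ j : Fin m, {p | π.next p.1 h' = some j} ∩
              ⋃ b : Bool, {p | π.bit j (p.2 j) p.1 h' = b} ∩ {_p | h' ++ [b] = h}) := by
      ext p
      simp only [Set.mem_ofPred_eq, Set.mem_iUnion, Set.mem_inter_iff, Set.mem_union]
      constructor
      · intro hp
        refine ⟨_, rfl, ?_⟩
        rcases hn : π.next p.1 (π.history p.1 p.2 t) with _ | j
        · left
          rw [π.history_succ_of_none hn] at hp
          exact ⟨rfl, hp⟩
        · right
          rw [π.history_succ_of_some hn] at hp
          exact ⟨j, rfl, _, rfl, hp⟩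
      · rintro ⟨h', rfl, ⟨hn, hp⟩ | ⟨j, hn, b, hb, hp⟩⟩
        · rw [π.history_succ_of_none hn, hp]
        · rw [π.history_succ_of_some hn, hb, hp]
    rw [this]
    refine MeasurableSet.iUnion fun h' => (ih h').inter (MeasurableSet.union ?_ ?_)
    · exact (measurable_fst (π.measurableSet_next h' none)).inter (MeasurableSet.const _)
    · refine MeasurableSet.iUnion fun j => ?_
      refine (measurable_fst (π.measurableSet_next h' (some j))).inter ?_
      refine MeasurableSet.iUnion fun b => MeasurableSet.inter ?_ (MeasurableSet.const _)
      have hg : Measurable fun p : R × (Fin m → X) => (p.2 j, p.1) := by fun_prop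
      have : Measurable fun p : R × (Fin m → X) => π.bit j (p.2 j) p.1 h' :=
        (π.measurable_bit j h').comp hg
      exact this (measurableSet_singleton b)

theorem measurableSet_output_history (π : Protocol m k X R) (B : ℕ) (i : Fin k) :
    MeasurableSet {p : R × (Fin m → X) | π.output p.1 (π.history p.1 p.2 B) = i} := by
  have : {p : R × (Fin m → X) | π.output p.1 (π.history p.1 p.2 B) = i} =
      ⋃ h : List Bool, {p | π.history p.1 p.2 B = h} ∩ {p | π.output p.1 h = i} := by
    ext p; simp
  rw [this]
  exact MeasurableSet.iUnion fun h => (π.measurableSet_history B h).inter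
    (measurable_fst (π.measurableSet_output h i))

/-- The inputs of party `j` that are consistent with the transcript `h`. -/
def consistent (π : Protocol m k X R) (r : R) (h : List Bool) (j : Fin m) : Set X :=
  {x | ∀ t, ∀ ht : t < h.length, π.next r (h.take t) = some j → π.bit j x r (h.take t) = h[t]}

/-- The parties that sent at least one bit of the transcript `h`. -/
def speakers (π : Protocol m k X R) (r : R) (h : List Bool) : Finset (Fin m) :=
  (Finset.range h.length).biUnion fun t => (π.next r (h.take t)).toFinset

theorem card_speakers_le (π : Protocol m k X R) (r : R) (h : List Bool) :
    (π.speakers r h).card ≤ h.length := by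
  refine Finset.card_biUnion_le.trans ?_
  calc _ ≤ ∑ _t ∈ Finset.range h.length, 1 := Finset.sum_le_sum fun t _ => by
        rw [Option.card_toFinset]
        rcases π.next r (h.take t) with _ | j <;> simp
    _ = h.length := by simp

theorem consistent_eq_univ (π : Protocol m k X R) {r : R} {h : List Bool} {j : Fin m}
    (hj : j ∉ π.speakers r h) : π.consistent r h j = Set.univ := by
  refine Set.eq_univ_of_forall fun x t ht hn => ?_
  exact absurd (Finset.mem_biUnion.2 ⟨t, Finset.mem_range.2 ht, by simp [hn]⟩) hj

theorem measurableSet_consistent (π : Protocol m k X R) (r : R) (h : List Bool) (j : Fin m) :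
    MeasurableSet (π.consistent r h j) := by
  have : π.consistent r h j = ⋂ t, ⋂ ht : t < h.length, ⋂ _ : π.next r (h.take t) = some j,
      {x | π.bit j x r (h.take t) = h[t]} := by
    ext x; simp [consistent]
  rw [this]
  refine MeasurableSet.iInter fun t => MeasurableSet.iInter fun ht =>
    MeasurableSet.iInter fun _ => ?_
  have : Measurable fun x => π.bit j x r (h.take t) :=
    (π.measurable_bit j _).comp measurable_prodMk_right
  exact this (measurableSet_singleton _)

theorem history_prefix (π : Protocol m k X R) (r : R) (x : Fin m → X) {s t : ℕ} (hst : s ≤ t) :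
    π.history r x s <+: π.history r x t := by
  induction t, hst using Nat.le_induction with
  | base => exact List.prefix_rfl
  | succ t _ ih =>
    refine ih.trans ?_
    rcases hn : π.next r (π.history r x t) with _ | j
    · rw [π.history_succ_of_none hn]
    · rw [π.history_succ_of_some hn]; exact List.prefix_append _ _

theorem mem_consistent_history (π : Protocol m k X R) (r : R) (x : Fin m → X) (B : ℕ)
    (j : Fin m) : x j ∈ π.consistent r (π.history r x B) j := by
  induction B with
  | zero => intro t ht; simp [history] at ht
  | succ B ih =>
    rcases hn : π.next r (π.history r x B) with _ | j'
    · rwa [π.history_succ_of_none hn]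
    · rw [π.history_succ_of_some hn]
      intro t ht hnext
      rw [List.length_append, List.length_singleton] at ht
      rcases Nat.lt_succ_iff_lt_or_eq.1 ht with h | h
      · rw [List.take_append_of_le_length h.le] at hnext ⊢
        rw [List.getElem_append_left h]
        exact ih t h hnext
      · subst h
        rw [List.take_left] at hnext ⊢
        rw [hn, Option.some_inj] at hnext
        subst hnext
        simp

/-- The rectangle property: the next speaker depends only on seed and history, so by induction on
time inputs that are separately consistent with a realised transcript reproduce it. -/
theorem history_eq_of_mem_consistent (π : Protocol m k X R) (r : R) (x x' : Fin m → X) (B : ℕ)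
    (h : ∀ j, x j ∈ π.consistent r (π.history r x' B) j) :
    π.history r x B = π.history r x' B := by
  have key : ∀ t ≤ B, π.history r x t = π.history r x' t := by
    intro t
    induction t with
    | zero => intro _; rfl
    | succ t ih =>
      intro ht
      have iht := ih (by omega)
      rcases hn : π.next r (π.history r x' t) with _ | j
      · rw [π.history_succ_of_none hn, π.history_succ_of_none (by rw [iht]; exact hn), iht]
      · have hp := π.history_prefix r x' ht
        rw [π.history_succ_of_some hn] at hp ⊢
        rw [π.history_succ_of_some (by rw [iht]; exact hn), iht]
        obtain ⟨l, hl⟩ := hp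
        have hlt : (π.history r x' t).length < (π.history r x' B).length := by
          rw [← hl]; simp
        have htake : (π.history r x' B).take (π.history r x' t).length = π.history r x' t := by
          rw [← hl]; simp
        have hb := h j _ hlt (by rw [htake]; exact hn)
        rw [htake] at hb
        rw [hb]
        congr 2
        simp only [← hl]
        simp
  exact key B le_rfl

end Protocol

/-! ### Elementary counting, logarithm and entropy estimates. -/

theorem card_lists_le (B : ℕ) (s : Finset (List Bool)) (hs : ∀ h ∈ s, h.length ≤ B) :
    s.card ≤ 2 ^ (B + 1) := by
  have hsub : s ⊆ (Finset.range (B + 1)).biUnion fun l =>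
      (Finset.univ : Finset (List.Vector Bool l)).image fun v => v.toList := by
    intro h hh
    refine Finset.mem_biUnion.2 ⟨h.length, Finset.mem_range.2 (Nat.lt_succ_of_le (hs h hh)), ?_⟩
    exact Finset.mem_image.2 ⟨⟨h, rfl⟩, Finset.mem_univ _, rfl⟩
  refine (Finset.card_le_card hsub).trans (Finset.card_biUnion_le.trans ?_)
  calc _ ≤ ∑ l ∈ Finset.range (B + 1), 2 ^ l := Finset.sum_le_sum fun l _ => by
        refine Finset.card_image_le.trans ?_
        rw [Finset.card_univ, card_vector, Fintype.card_bool]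
    _ ≤ 2 ^ (B + 1) := by
        rw [Nat.geomSum_eq le_rfl]; simp

theorem measureReal_cond_apply {X : Type*} [MeasurableSpace X] {G : Set X} (hG : MeasurableSet G)
    (M : Measure X) (E : Set X) :
    (ProbabilityTheory.cond M G).real E = (M.real G)⁻¹ * M.real (G ∩ E) := by
  rw [Measure.real, ProbabilityTheory.cond_apply hG, ENNReal.toReal_mul, ENNReal.toReal_inv]
  rfl

theorem sub_one_sub_le_log {r : ℝ} (hr : 1 / 2 ≤ r) : r - 1 - 2 * (r - 1) ^ 2 ≤ Real.log r := by
  have h0 : 0 < r := by linarith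
  refine le_trans ?_ (Real.one_sub_inv_le_log_of_pos h0)
  have : 1 - r⁻¹ = (r - 1) / r := by field_simp
  rw [this, le_div_iff₀ h0]
  nlinarith [mul_nonneg (sq_nonneg (r - 1)) (by linarith : 0 ≤ 2 * r - 1)]

theorem one_add_half_log_le_sqrt {y : ℝ} (hy : 0 < y) : 1 + Real.log y / 2 ≤ √y := by
  have h := Real.log_le_sub_one_of_pos (Real.sqrt_pos.2 hy)
  rw [Real.log_sqrt hy.le] at h
  linarith

/-- Gibbs' inequality against the uniform law, from log u ≤ u − 1 at u = 1/(p l · card). -/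
theorem sum_neg_mul_log_le_log_card {Λ : Type*} [Fintype Λ] (p : Λ → ℝ)
    (hp : ∀ l, 0 ≤ p l) (hp1 : ∑ l, p l = 1) :
    ∑ l, p l * -Real.log (p l) ≤ Real.log (Fintype.card Λ) := by
  have hne : Nonempty Λ := by
    by_contra h
    rw [not_nonempty_iff] at h
    simp at hp1
  have hc : (0 : ℝ) < Fintype.card Λ := by exact_mod_cast Fintype.card_pos
  have hpt : ∀ l, p l * -Real.log (p l) ≤
      p l * Real.log (Fintype.card Λ) + ((Fintype.card Λ : ℝ)⁻¹ - p l) := fun l => by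
    rcases (hp l).eq_or_lt with h | h
    · rw [← h]; simp
    · have h1 := Real.log_le_sub_one_of_pos (x := (p l * Fintype.card Λ)⁻¹) (by positivity)
      rw [Real.log_inv, Real.log_mul h.ne' hc.ne'] at h1
      have h2 := mul_le_mul_of_nonneg_left h1 h.le
      have h3 : p l * ((p l * (Fintype.card Λ : ℝ))⁻¹ - 1) = (Fintype.card Λ : ℝ)⁻¹ - p l := by
        field_simp
      linarith
  refine (Finset.sum_le_sum fun l _ => hpt l).trans ?_
  rw [Finset.sum_add_distrib, ← Finset.sum_mul, hp1, Finset.sum_sub_distrib, hp1]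
  simp [hc.ne']

/-! ### Product measures on partitions into rectangles -/

/-- A partition of `Fin m → X` into measurable rectangles, each of which restricts at most `B`
coordinates. -/
structure RectanglePartition (m B : ℕ) (X Λ : Type*) [MeasurableSpace X] where
  side : Λ → Fin m → Set X
  measurableSet_side : ∀ l j, MeasurableSet (side l j)
  existsUnique : ∀ x : Fin m → X, ∃! l, ∀ j, x j ∈ side l j
  support : Λ → Finset (Fin m)
  card_support_le : ∀ l, (support l).card ≤ B
  side_eq_univ : ∀ l, ∀ j ∉ support l, side l j = Set.univ

namespace RectanglePartition

variable {m B : ℕ} {X Λ : Type*} [MeasurableSpace X]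

/-- The probability of the rectangle `l` under a power of `M`. -/
noncomputable def mass (P : RectanglePartition m B X Λ) (M : Measure X) (l : Λ) : ℝ :=
  ∏ j, M.real (P.side l j)

theorem mass_nonneg (P : RectanglePartition m B X Λ) (M : Measure X) (l : Λ) : 0 ≤ P.mass M l :=
  Finset.prod_nonneg fun _ _ => measureReal_nonneg

/-- The factors may differ because hybrids with a single changed coordinate are needed for the
affinity bound. -/
theorem sum_prod_eq (P : RectanglePartition m B X Λ) (ν : Fin m → Measure X)
    [∀ j, IsProbabilityMeasure (ν j)] (A : Finset Λ) :
    ∑ l ∈ A, ∏ j, (ν j).real (P.side l j) =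
      (Measure.pi ν).real {x | ∃ l ∈ A, ∀ j, x j ∈ P.side l j} := by
  have h1 : ∀ l, ∏ j, (ν j).real (P.side l j) =
      (Measure.pi ν).real (Set.pi Set.univ (P.side l)) := fun l => by
    simp [Measure.real, Measure.pi_pi, ENNReal.toReal_prod]
  have h2 : {x : Fin m → X | ∃ l ∈ A, ∀ j, x j ∈ P.side l j} =
      ⋃ l ∈ A, Set.pi Set.univ (P.side l) := by
    ext x; simp
  rw [h2, measureReal_biUnion_finset]
  · exact Finset.sum_congr rfl fun l _ => h1 l
  · intro l _ l' _ hne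
    refine Set.disjoint_left.2 fun x hx hx' => hne ?_
    exact (P.existsUnique x).unique (by simpa using hx) (by simpa using hx')
  · exact fun l _ => MeasurableSet.univ_pi fun j => P.measurableSet_side l j

theorem sum_prod_eq_one [Fintype Λ] (P : RectanglePartition m B X Λ) (ν : Fin m → Measure X)
    [∀ j, IsProbabilityMeasure (ν j)] : ∑ l, ∏ j, (ν j).real (P.side l j) = 1 := by
  rw [P.sum_prod_eq ν Finset.univ]
  have : {x : Fin m → X | ∃ l ∈ Finset.univ, ∀ j, x j ∈ P.side l j} = Set.univ :=
    Set.eq_univ_of_forall fun x => by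
      obtain ⟨l, hl, -⟩ := P.existsUnique x
      exact ⟨l, Finset.mem_univ _, hl⟩
  rw [this, probReal_univ]

theorem sum_mass [Fintype Λ] (P : RectanglePartition m B X Λ) (M : Measure X)
    [IsProbabilityMeasure M] :
    ∑ l, P.mass M l = 1 :=
  P.sum_prod_eq_one fun _ => M

/-- The sum of the squared relative deviations of the sides of the rectangle `l`. -/
noncomputable def deviation (P : RectanglePartition m B X Λ) (N₀ N : Measure X) (l : Λ) : ℝ :=
  ∑ j, (N.real (P.side l j) / N₀.real (P.side l j) - 1) ^ 2

theorem deviation_nonneg (P : RectanglePartition m B X Λ) (N₀ N : Measure X) (l : Λ) :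
    0 ≤ P.deviation N₀ N l :=
  Finset.sum_nonneg fun _ _ => sq_nonneg _

/-- With r_j the ratios of side probabilities, √(∏ r_j) ≥ 1 + ½ Σ log r_j ≥ 1 + ½ Σ (r_j − 1) − Σ
(r_j − 1)². The linear terms cancel on summation: mass times r_j is the probability of the rectangle
when coordinate j alone is drawn from N, and these also sum to 1. -/
theorem one_sub_le_affinity [Fintype Λ] (P : RectanglePartition m B X Λ) (N₀ N : Measure X)
    [IsProbabilityMeasure N₀] [IsProbabilityMeasure N]
    (hac : ∀ E, MeasurableSet E → N₀.real E = 0 → N.real E = 0)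
    (hlow : ∀ E, MeasurableSet E → 1 / 2 * N₀.real E ≤ N.real E) :
    1 - ∑ l, P.mass N₀ l * P.deviation N₀ N l ≤ ∑ l, √(P.mass N₀ l * P.mass N l) := by
  set ν : Fin m → Fin m → Measure X := fun j => Function.update (fun _ => N₀) j N with hν
  have hprob : ∀ j j', IsProbabilityMeasure (ν j j') := fun j j' => by
    simp only [hν, Function.update_apply]; split_ifs <;> infer_instance
  have hνsum : ∀ j, ∑ l, ∏ j', (ν j j').real (P.side l j') = 1 := fun j => P.sum_prod_eq_one (ν j)
  have hpt : ∀ l, P.mass N₀ l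
      + (∑ j, (∏ j', (ν j j').real (P.side l j') - P.mass N₀ l)) / 2
      - P.mass N₀ l * P.deviation N₀ N l ≤ √(P.mass N₀ l * P.mass N l) := by
    intro l
    have hupd : ∀ j, ∏ j', (ν j j').real (P.side l j') =
        P.mass N₀ l * (N.real (P.side l j) / N₀.real (P.side l j)) := fun j => by
      have h1 : ∏ j', (ν j j').real (P.side l j') =
          N.real (P.side l j) * ∏ j' ∈ Finset.univ.erase j, N₀.real (P.side l j') := by
        rw [← Finset.mul_prod_erase _ _ (Finset.mem_univ j)]
        congr 1
        · simp [hν]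
        · exact Finset.prod_congr rfl fun j' hj' => by
            simp [hν, Function.update_of_ne (Finset.ne_of_mem_erase hj')]
      rw [h1, mass, ← Finset.mul_prod_erase _ _ (Finset.mem_univ j)]
      by_cases h0 : N₀.real (P.side l j) = 0
      · rw [hac _ (P.measurableSet_side l j) h0]; simp
      · field_simp
    by_cases hz : P.mass N₀ l = 0
    · simp [hupd, hz]
    · have hq : ∀ j, 0 < N₀.real (P.side l j) := fun j =>
        lt_of_le_of_ne measureReal_nonneg (Ne.symm (Finset.prod_ne_zero_iff.1 hz j
          (Finset.mem_univ j)))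
      have hpos : 0 < P.mass N₀ l := Finset.prod_pos fun j _ => hq j
      have hr : ∀ j, 1 / 2 ≤ N.real (P.side l j) / N₀.real (P.side l j) := fun j => by
        rw [le_div_iff₀ (hq j)]; exact hlow _ (P.measurableSet_side l j)
      have hrpos : ∀ j, 0 < N.real (P.side l j) / N₀.real (P.side l j) := fun j => by
        linarith [hr j]
      have hm : P.mass N₀ l * P.mass N l = P.mass N₀ l ^ 2 *
          ∏ j, (N.real (P.side l j) / N₀.real (P.side l j)) := by
        rw [Finset.prod_div_distrib]
        change _ = P.mass N₀ l ^ 2 * (P.mass N l / P.mass N₀ l)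
        field_simp
      rw [hm, Real.sqrt_mul (sq_nonneg _), Real.sqrt_sq hpos.le]
      have h1 := one_add_half_log_le_sqrt (Finset.prod_pos fun j (_ : j ∈ Finset.univ) => hrpos j)
      rw [Real.log_prod fun j _ => (hrpos j).ne'] at h1
      have h2 : ∑ j, (N.real (P.side l j) / N₀.real (P.side l j) - 1
          - 2 * (N.real (P.side l j) / N₀.real (P.side l j) - 1) ^ 2) ≤
          ∑ j, Real.log (N.real (P.side l j) / N₀.real (P.side l j)) :=
        Finset.sum_le_sum fun j _ => sub_one_sub_le_log (hr j)
      rw [Finset.sum_sub_distrib, ← Finset.mul_sum] at h2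
      have h3 : ∑ j, (∏ j', (ν j j').real (P.side l j') - P.mass N₀ l) =
          P.mass N₀ l * ∑ j, (N.real (P.side l j) / N₀.real (P.side l j) - 1) := by
        rw [Finset.mul_sum]
        exact Finset.sum_congr rfl fun j _ => by rw [hupd]; ring
      rw [h3]
      have h4 := mul_le_mul_of_nonneg_left h1 hpos.le
      have h5 := mul_le_mul_of_nonneg_left h2 hpos.le
      unfold deviation
      linarith
  have hsum := Finset.sum_le_sum fun l (_ : l ∈ Finset.univ) => hpt l
  rw [Finset.sum_sub_distrib, Finset.sum_add_distrib, P.sum_mass, ← Finset.sum_div,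
    Finset.sum_comm] at hsum
  have : ∀ j, ∑ l, (∏ j', (ν j j').real (P.side l j') - P.mass N₀ l) = 0 := fun j => by
    rw [Finset.sum_sub_distrib, hνsum, P.sum_mass, sub_self]
  simp only [this, Finset.sum_const_zero] at hsum
  linarith

/-- Only restricted sides deviate, and the −log of their probabilities add up to −log of the mass,
whose average is the entropy of the partition. -/
theorem sum_mass_mul_deviation_le [Fintype Λ] (P : RectanglePartition m B X Λ) {k : ℕ}
    (N₀ : Measure X)
    (N : Fin k → Measure X) [IsProbabilityMeasure N₀] [∀ i, IsProbabilityMeasure (N i)] {K : ℝ}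
    (hK0 : 0 ≤ K)
    (hK : ∀ E, MeasurableSet E → 0 < N₀.real E →
      ∑ i, ((N i).real E / N₀.real E - 1) ^ 2 ≤ K * (3 - Real.log (N₀.real E))) :
    ∑ i, ∑ l, P.mass N₀ l * P.deviation N₀ (N i) l ≤
      K * (Real.log (Fintype.card Λ) + 3 * B) := by
  have hpt : ∀ l, P.mass N₀ l * ∑ i, P.deviation N₀ (N i) l ≤
      K * (P.mass N₀ l * -Real.log (P.mass N₀ l)) + K * (3 * B) * P.mass N₀ l := fun l => by
    rcases (P.mass_nonneg N₀ l).eq_or_lt with h | h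
    · rw [← h]; simp
    · have hq : ∀ j, 0 < N₀.real (P.side l j) := fun j =>
        lt_of_le_of_ne measureReal_nonneg (Ne.symm (Finset.prod_ne_zero_iff.1 h.ne' j
          (Finset.mem_univ j)))
      have h1 : ∑ i, P.deviation N₀ (N i) l ≤
          ∑ j ∈ P.support l, K * (3 - Real.log (N₀.real (P.side l j))) := by
        unfold deviation
        rw [Finset.sum_comm]
        rw [← Finset.sum_subset (Finset.subset_univ (P.support l))]
        · exact Finset.sum_le_sum fun j _ => hK _ (P.measurableSet_side l j) (hq j)
        · intro j _ hj
          simp [P.side_eq_univ l j hj]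
      have h2 : Real.log (P.mass N₀ l) = ∑ j ∈ P.support l, Real.log (N₀.real (P.side l j)) := by
        rw [mass, Real.log_prod fun j _ => (hq j).ne',
          ← Finset.sum_subset (Finset.subset_univ (P.support l))]
        intro j _ hj
        simp [P.side_eq_univ l j hj]
      have h3 : ∑ j ∈ P.support l, K * (3 - Real.log (N₀.real (P.side l j))) ≤
          K * (3 * B - Real.log (P.mass N₀ l)) := by
        rw [h2, ← Finset.mul_sum, Finset.sum_sub_distrib, Finset.sum_const, nsmul_eq_mul]
        have : ((P.support l).card : ℝ) ≤ B := by exact_mod_cast P.card_support_le l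
        exact mul_le_mul_of_nonneg_left (by linarith) hK0
      have := mul_le_mul_of_nonneg_left (h1.trans h3) h.le
      linarith
  rw [Finset.sum_comm]
  simp_rw [← Finset.mul_sum]
  refine (Finset.sum_le_sum fun l _ => hpt l).trans ?_
  rw [Finset.sum_add_distrib, ← Finset.mul_sum, ← Finset.mul_sum, P.sum_mass]
  have := mul_le_mul_of_nonneg_left
    (sum_neg_mul_log_le_log_card (P.mass N₀) (P.mass_nonneg N₀) (P.sum_mass N₀)) hK0
  linarith

/-- Conditioning costs a factor 1/γ only at restricted coordinates, so the exponent is B and not the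
number of parties. -/
theorem pow_mul_mass_cond_le (P : RectanglePartition m B X Λ) (M : Measure X)
    [IsProbabilityMeasure M] {G : Set X} (hG : MeasurableSet G) {γ : ℝ} (hγ0 : 0 < γ)
    (hγ : γ ≤ M.real G) (l : Λ) :
    γ ^ B * P.mass (ProbabilityTheory.cond M G) l ≤ P.mass M l := by
  have hγ1 : γ ≤ 1 := hγ.trans measureReal_le_one
  have hcond : ∀ E, γ * (ProbabilityTheory.cond M G).real E ≤ M.real E := fun E => by
    rw [measureReal_cond_apply hG]
    have hG0 : 0 < M.real G := hγ0.trans_le hγ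
    calc γ * ((M.real G)⁻¹ * M.real (G ∩ E)) ≤ M.real G * ((M.real G)⁻¹ * M.real (G ∩ E)) :=
          mul_le_mul_of_nonneg_right hγ (by positivity)
      _ = M.real (G ∩ E) := by field_simp
      _ ≤ M.real E := measureReal_mono Set.inter_subset_right
  have hG0 : M G ≠ 0 := by
    intro h
    simp [Measure.real, h] at hγ
    linarith
  have : IsProbabilityMeasure (ProbabilityTheory.cond M G) :=
    ProbabilityTheory.cond_isProbabilityMeasure hG0
  calc γ ^ B * P.mass (ProbabilityTheory.cond M G) l
      ≤ γ ^ (P.support l).card * P.mass (ProbabilityTheory.cond M G) l :=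
        mul_le_mul_of_nonneg_right
          (pow_le_pow_of_le_one hγ0.le hγ1 (P.card_support_le l)) (P.mass_nonneg _ l)
    _ = ∏ j, ((if j ∈ P.support l then γ else 1) *
          (ProbabilityTheory.cond M G).real (P.side l j)) := by
        rw [Finset.prod_mul_distrib, Finset.prod_ite_mem, Finset.univ_inter, Finset.prod_const,
          mass]
    _ ≤ P.mass M l := by
        refine Finset.prod_le_prod (fun j _ => ?_) fun j _ => ?_
        · split_ifs <;> positivity
        · split_ifs with hj
          · exact hcond _
          · rw [P.side_eq_univ l j hj]; simp

end RectanglePartition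

/-! ### From affinity to success probabilities. -/

theorem sum_sub_le_of_affinity {Λ : Type*} [Fintype Λ] (p q : Λ → ℝ) (hp : ∀ l, 0 ≤ p l)
    (hq : ∀ l, 0 ≤ q l) (hp1 : ∑ l, p l = 1) (hq1 : ∑ l, q l = 1) (A : Finset Λ) :
    ∑ l ∈ A, q l - ∑ l ∈ A, p l ≤ 24 * (1 - ∑ l, √(p l * q l)) + 1 / 12 := by
  -- q − p = (√q − √p)(√q + √p) ≤ 12(√q − √p)² + (√q + √p)²/48; the last part sums to at most 1/12.
  have hpt : ∀ l, q l - p l ≤ 12 * (p l + q l - 2 * √(p l * q l))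
      + (p l + q l + 2 * √(p l * q l)) / 48 := fun l => by
    rw [Real.sqrt_mul (hp l)]
    have h1 := Real.sq_sqrt (hp l)
    have h2 := Real.sq_sqrt (hq l)
    nlinarith [sq_nonneg (24 * (√(q l) - √(p l)) - (√(q l) + √(p l)))]
  have hle : ∀ l, √(p l * q l) ≤ (p l + q l) / 2 := fun l => by
    rw [Real.sqrt_mul (hp l)]
    nlinarith [sq_nonneg (√(p l) - √(q l)), Real.sq_sqrt (hp l), Real.sq_sqrt (hq l)]
  have hnn : ∀ l, 0 ≤ 12 * (p l + q l - 2 * √(p l * q l))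
      + (p l + q l + 2 * √(p l * q l)) / 48 := fun l => by
    have := hle l
    have := hp l
    have := hq l
    have := Real.sqrt_nonneg (p l * q l)
    linarith
  have haff : ∑ l, √(p l * q l) ≤ 1 := by
    refine (Finset.sum_le_sum fun l _ => hle l).trans ?_
    rw [← Finset.sum_div, Finset.sum_add_distrib, hp1, hq1]; norm_num
  rw [← Finset.sum_sub_distrib]
  calc ∑ l ∈ A, (q l - p l) ≤ ∑ l ∈ A, (12 * (p l + q l - 2 * √(p l * q l))
      + (p l + q l + 2 * √(p l * q l)) / 48) := Finset.sum_le_sum fun l _ => hpt l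
    _ ≤ ∑ l, (12 * (p l + q l - 2 * √(p l * q l))
      + (p l + q l + 2 * √(p l * q l)) / 48) :=
        Finset.sum_le_sum_of_subset_of_nonneg (Finset.subset_univ _) fun l _ _ => hnn l
    _ = 12 * (2 - 2 * ∑ l, √(p l * q l)) + (2 + 2 * ∑ l, √(p l * q l)) / 48 := by
        rw [Finset.sum_add_distrib, ← Finset.mul_sum, ← Finset.sum_div, Finset.sum_sub_distrib,
          Finset.sum_add_distrib, Finset.sum_add_distrib, ← Finset.mul_sum, Finset.sum_add_distrib,
          hp1, hq1]
        norm_num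
    _ ≤ _ := by linarith

/-- The success probabilities under M₀ sum to 1, and each M i adds only an affinity defect. That
defect is estimated for the laws conditioned on G and transferred back at the cost (1 − δ)^B ≥ 1 −
Bδ. -/
theorem sum_success_le {m B k : ℕ} {X Λ : Type*} [MeasurableSpace X] [Fintype Λ]
    (P : RectanglePartition m B X Λ) (M₀ : Measure X) (M : Fin k → Measure X)
    [IsProbabilityMeasure M₀] [∀ i, IsProbabilityMeasure (M i)] {G : Set X} (hG : MeasurableSet G)
    {δ K : ℝ} (hδ0 : 0 ≤ δ) (hδ1 : δ ≤ 1 / 4) (hG₀ : 1 - δ ≤ M₀.real G)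
    (hGi : ∀ i, 1 - δ ≤ (M i).real G)
    (hac : ∀ i E, MeasurableSet E → M₀.real E = 0 → (M i).real E = 0)
    (hlow : ∀ i E, MeasurableSet E → 1 / 2 * (ProbabilityTheory.cond M₀ G).real E ≤
      (ProbabilityTheory.cond (M i) G).real E)
    (hK0 : 0 ≤ K)
    (hK : ∀ E, MeasurableSet E → 0 < (ProbabilityTheory.cond M₀ G).real E →
      ∑ i, ((ProbabilityTheory.cond (M i) G).real E / (ProbabilityTheory.cond M₀ G).real E - 1) ^ 2
        ≤ K * (3 - Real.log ((ProbabilityTheory.cond M₀ G).real E)))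
    (out : Λ → Fin k) :
    ∑ i, ∑ l with out l = i, P.mass (M i) l ≤
      1 + 24 * (k * (B * δ) + K * (Real.log (Fintype.card Λ) + 3 * B)) + k / 12 := by
  have hne : ∀ (Q : Measure X), 1 - δ ≤ Q.real G → Q G ≠ 0 := fun Q hQ h => by
    simp [Measure.real, h] at hQ
    linarith
  have hN₀ : IsProbabilityMeasure (ProbabilityTheory.cond M₀ G) :=
    ProbabilityTheory.cond_isProbabilityMeasure (hne _ hG₀)
  have hN : ∀ i, IsProbabilityMeasure (ProbabilityTheory.cond (M i) G) := fun i =>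
    ProbabilityTheory.cond_isProbabilityMeasure (hne _ (hGi i))
  set D : Fin k → ℝ := fun i => ∑ l, P.mass (ProbabilityTheory.cond M₀ G) l *
    P.deviation (ProbabilityTheory.cond M₀ G) (ProbabilityTheory.cond (M i) G) l with hD
  have hD0 : ∀ i, 0 ≤ D i := fun i => Finset.sum_nonneg fun l _ =>
    mul_nonneg (P.mass_nonneg _ l) (P.deviation_nonneg _ _ l)
  have haff : ∀ i, 1 - B * δ - D i ≤ ∑ l, √(P.mass M₀ l * P.mass (M i) l) := fun i => by
    have h1 := P.one_sub_le_affinity (ProbabilityTheory.cond M₀ G)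
      (ProbabilityTheory.cond (M i) G) (fun E hE h0 => by
        rw [measureReal_cond_apply hG] at h0 ⊢
        have hG0 : M₀.real G ≠ 0 := by linarith
        have h2 := (mul_eq_zero.1 h0).resolve_left (inv_ne_zero hG0)
        rw [hac i _ (hG.inter hE) h2, mul_zero]) (hlow i)
    have h2 : (1 - δ) ^ B * ∑ l, √(P.mass (ProbabilityTheory.cond M₀ G) l *
        P.mass (ProbabilityTheory.cond (M i) G) l) ≤ ∑ l, √(P.mass M₀ l * P.mass (M i) l) := by
      rw [Finset.mul_sum]
      refine Finset.sum_le_sum fun l _ => ?_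
      have h3 := P.pow_mul_mass_cond_le M₀ hG (by linarith : 0 < 1 - δ) hG₀ l
      have h4 := P.pow_mul_mass_cond_le (M i) hG (by linarith : 0 < 1 - δ) (hGi i) l
      have hpow : 0 ≤ (1 - δ) ^ B := pow_nonneg (by linarith) B
      refine Real.le_sqrt_of_sq_le ?_
      rw [mul_pow, Real.sq_sqrt (mul_nonneg (P.mass_nonneg _ l) (P.mass_nonneg _ l))]
      have h5 := mul_le_mul h3 h4 (mul_nonneg hpow (P.mass_nonneg _ l)) (P.mass_nonneg _ l)
      linarith
    have h3 : 1 - B * δ ≤ (1 - δ) ^ B := by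
      have := one_add_mul_le_pow (a := -δ) (by linarith) B
      rw [← sub_eq_add_neg] at this
      linarith
    have h4 : (1 - δ) ^ B ≤ 1 := pow_le_one₀ (by linarith) (by linarith)
    have h5 : (1 - δ) ^ B * (1 - D i) ≤ ∑ l, √(P.mass M₀ l * P.mass (M i) l) :=
      (mul_le_mul_of_nonneg_left h1 (pow_nonneg (by linarith) B)).trans h2
    nlinarith [hD0 i]
  have hsub : ∀ i, ∑ l with out l = i, P.mass (M i) l ≤
      ∑ l with out l = i, P.mass M₀ l + (24 * (B * δ + D i) + 1 / 12) := fun i => by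
    have := sum_sub_le_of_affinity (P.mass M₀) (P.mass (M i)) (P.mass_nonneg _) (P.mass_nonneg _)
      (P.sum_mass _) (P.sum_mass _) {l | out l = i}
    linarith [haff i]
  refine (Finset.sum_le_sum fun i _ => hsub i).trans ?_
  have hone : ∑ i, ∑ l with out l = i, P.mass M₀ l = 1 := by
    rw [Finset.sum_fiberwise, P.sum_mass]
  have hDsum := P.sum_mass_mul_deviation_le (ProbabilityTheory.cond M₀ G)
    (fun i => ProbabilityTheory.cond (M i) G) hK0 hK
  have hcalc : ∑ i, (24 * (B * δ + D i) + 1 / 12) = 24 * (k * (B * δ) + ∑ i, D i) + k / 12 := by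
    rw [Finset.sum_add_distrib, ← Finset.mul_sum, Finset.sum_add_distrib]
    simp; ring
  rw [Finset.sum_add_distrib, hone, hcalc]
  linarith

/-! ### Densities of a centered family -/

/-- The setwise bounds confine the derivative almost everywhere; clipping to [−ρ, ρ] makes this hold
everywhere, as the pointwise estimates require. -/
theorem IsCenteredFamily.exists_density {Ω : Type*} [MeasurableSpace Ω] {k : ℕ} {ρ : ℝ}
    {μ₀ : Measure Ω} {μ : Fin k → Measure Ω} (h : IsCenteredFamily ρ μ₀ μ) :
    ∃ F : Fin k → Ω → ℝ, (∀ i, Measurable (F i)) ∧ (∀ i a, |F i a| ≤ ρ) ∧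
      (∀ i, (fun a => ((μ i).rnDeriv μ₀ a).toReal - 1) =ᵐ[μ₀] F i) ∧
      ∀ i, μ i = μ₀.withDensity fun a => ENNReal.ofReal (1 + F i a) := by
  have := h.prob_center
  have := h.prob
  have hρ := h.rho_pos
  have hac : ∀ i, μ i ≪ μ₀ := fun i => Measure.AbsolutelyContinuous.mk fun E hE h0 => by
    have h1 := h.upper i E hE
    have h2 : μ₀.real E = 0 := by simp [Measure.real, h0]
    rw [h2, mul_zero] at h1
    exact (measureReal_eq_zero_iff).1 (le_antisymm h1 measureReal_nonneg)
  have hint : ∀ i, Integrable (fun a => ((μ i).rnDeriv μ₀ a).toReal) μ₀ := fun i =>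
    Measure.integrable_toReal_rnDeriv
  have hup : ∀ i, (fun a => ((μ i).rnDeriv μ₀ a).toReal) ≤ᵐ[μ₀] fun _ => 1 + ρ := fun i =>
    ae_le_of_forall_setIntegral_le (hint i) (integrable_const _) fun s hs _ => by
      rw [Measure.setIntegral_toReal_rnDeriv (hac i), setIntegral_const, smul_eq_mul, mul_comm]
      exact h.upper i s hs
  have hlo : ∀ i, (fun _ => 1 - ρ) ≤ᵐ[μ₀] fun a => ((μ i).rnDeriv μ₀ a).toReal := fun i =>
    ae_le_of_forall_setIntegral_le (integrable_const _) (hint i) fun s hs _ => by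
      rw [Measure.setIntegral_toReal_rnDeriv (hac i), setIntegral_const, smul_eq_mul, mul_comm]
      exact h.lower i s hs
  have hae : ∀ i, (fun a => ((μ i).rnDeriv μ₀ a).toReal - 1) =ᵐ[μ₀]
      fun a => max (-ρ) (min ρ (((μ i).rnDeriv μ₀ a).toReal - 1)) := fun i => by
    filter_upwards [hup i, hlo i] with a h1 h2
    rw [min_eq_right (by linarith), max_eq_right (by linarith)]
  refine ⟨fun i a => max (-ρ) (min ρ (((μ i).rnDeriv μ₀ a).toReal - 1)), fun i => ?_,
    fun i a => ?_, hae, fun i => ?_⟩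
  · have := Measure.measurable_rnDeriv (μ i) μ₀
    fun_prop
  · exact abs_le.2 ⟨le_max_left _ _, max_le (by linarith) (min_le_left _ _)⟩
  · rw [← Measure.withDensity_rnDeriv_eq _ _ (hac i)]
    refine withDensity_congr_ae ?_
    filter_upwards [hae i, Measure.rnDeriv_lt_top (μ i) μ₀] with a ha hlt
    rw [← ha, add_sub_cancel, ENNReal.ofReal_toReal hlt.ne]

theorem pi_withDensity_ofReal {Ω : Type*} [MeasurableSpace Ω] {n : ℕ} (μ₀ μ : Measure Ω)
    [IsProbabilityMeasure μ₀] [IsProbabilityMeasure μ] {g : Ω → ℝ} (hg : Integrable g μ₀)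
    (hg0 : ∀ a, 0 ≤ g a) (hμ : μ = μ₀.withDensity fun a => ENNReal.ofReal (g a)) :
    (Measure.pi fun _ : Fin n => μ) =
      (Measure.pi fun _ : Fin n => μ₀).withDensity fun x => ENNReal.ofReal (∏ t, g (x t)) := by
  refine Measure.pi_eq fun s hs => ?_
  rw [withDensity_apply _ (MeasurableSet.univ_pi hs), Measure.restrict_pi_pi,
    ← ofReal_integral_eq_lintegral_ofReal]
  · rw [integral_fintype_prod_eq_prod (f := fun _ => g),
      ENNReal.ofReal_prod_of_nonneg fun t _ => integral_nonneg hg0]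
    refine Finset.prod_congr rfl fun t _ => ?_
    rw [hμ, withDensity_apply _ (hs t), ofReal_integral_eq_lintegral_ofReal hg.integrableOn
      (ae_of_all _ hg0)]
  · exact Integrable.fintype_prod fun t => hg.integrableOn
  · exact ae_of_all _ fun x => Finset.prod_nonneg fun t _ => hg0 _

theorem integrable_of_abs_le {X : Type*} [MeasurableSpace X] {M : Measure X} [IsFiniteMeasure M]
    {g : X → ℝ} (hg : Measurable g) {C : ℝ} (hC : ∀ x, |g x| ≤ C) : Integrable g M :=
  Integrable.of_bound hg.aestronglyMeasurable C (ae_of_all _ hC)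

theorem measureReal_pi_eq_setIntegral {Ω : Type*} [MeasurableSpace Ω] {n : ℕ} (μ₀ μ : Measure Ω)
    [IsProbabilityMeasure μ₀] [IsProbabilityMeasure μ] {g : Ω → ℝ} (hg : Integrable g μ₀)
    (hg0 : ∀ a, 0 ≤ g a) (hμ : μ = μ₀.withDensity fun a => ENNReal.ofReal (g a))
    {E : Set (Fin n → Ω)} (hE : MeasurableSet E) :
    (Measure.pi fun _ : Fin n => μ).real E =
      ∫ x in E, ∏ t, g (x t) ∂(Measure.pi fun _ : Fin n => μ₀) := by
  rw [Measure.real, pi_withDensity_ofReal μ₀ μ hg hg0 hμ, withDensity_apply _ hE,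
    ← ofReal_integral_eq_lintegral_ofReal, ENNReal.toReal_ofReal]
  · exact integral_nonneg fun x => Finset.prod_nonneg fun t _ => hg0 _
  · exact (Integrable.fintype_prod fun t => hg).integrableOn
  · exact ae_of_all _ fun x => Finset.prod_nonneg fun t _ => hg0 _

/-! ### Concentration of the likelihood ratios -/

/-- The product lies between exp(Σ f − 2ε²) and exp(Σ f), and 2ε ≤ L absorbs the shift 2ε² into εL.
-/
theorem abs_prod_one_add_sub_one_le {n : ℕ} {ρ ε L : ℝ} (f : Fin n → ℝ) (hf : ∀ t, |f t| ≤ ρ)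
    (hρ : ρ ≤ 1 / 4) (hε0 : 0 < ε) (hε : (n : ℝ) * ρ ^ 2 = ε ^ 2) (hL : 2 * ε ≤ L)
    (hεL : ε * L ≤ 1) (hsum : |∑ t, f t| ≤ ε * L) : |∏ t, (1 + f t) - 1| ≤ 2 * ε * L := by
  have hs := abs_le.1 hsum
  have hpos : ∀ t, 0 < 1 + f t := fun t => by have := abs_le.1 (hf t); linarith
  have hup : ∏ t, (1 + f t) ≤ Real.exp (∑ t, f t) := by
    rw [Real.exp_sum]
    exact Finset.prod_le_prod (fun t _ => (hpos t).le)
      fun t _ => by linarith [Real.add_one_le_exp (f t)]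
  have hlo : Real.exp (∑ t, f t - 2 * ε ^ 2) ≤ ∏ t, (1 + f t) := by
    have h1 : ∑ t, f t - 2 * ε ^ 2 ≤ ∑ t, (f t - 2 * f t ^ 2) := by
      rw [Finset.sum_sub_distrib, ← Finset.mul_sum, ← hε]
      have : ∑ t, f t ^ 2 ≤ ∑ _t : Fin n, ρ ^ 2 := Finset.sum_le_sum fun t _ => by
        have := abs_le.1 (hf t); exact sq_le_sq' this.1 this.2
      simp only [Finset.sum_const, Finset.card_univ, Fintype.card_fin, nsmul_eq_mul] at this
      linarith
    refine (Real.exp_le_exp.2 h1).trans ?_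
    rw [Real.exp_sum]
    refine Finset.prod_le_prod (fun t _ => (Real.exp_pos _).le) fun t _ => ?_
    have h2 := sub_one_sub_le_log (r := 1 + f t)
      (by have := abs_le.1 (hf t); linarith)
    rw [← Real.le_log_iff_exp_le (hpos t)]
    simpa using h2
  rw [abs_le]
  constructor
  · have := Real.add_one_le_exp (∑ t, f t - 2 * ε ^ 2)
    nlinarith
  · have h1 := (abs_le.1 (Real.abs_exp_sub_one_sub_id_le (hsum.trans hεL))).2
    have h2 : (∑ t, f t) ^ 2 ≤ (ε * L) ^ 2 := sq_le_sq' hs.1 hs.2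
    have h3 : 0 ≤ ε * L := (abs_nonneg _).trans hsum
    nlinarith

/-- Hoeffding: each summand is sub-Gaussian with parameter ρ², the sum with nρ² = ε². -/
theorem measureReal_sum_ge_le {Ω : Type*} [MeasurableSpace Ω] {n : ℕ}
    (μ₀ : Measure Ω) [IsProbabilityMeasure μ₀] {ρ ε L : ℝ} {f : Ω → ℝ} (hfm : Measurable f)
    (hf : ∀ a, |f a| ≤ ρ) (hf0 : ∫ a, f a ∂μ₀ = 0) (hρ : 0 < ρ) (hε0 : 0 < ε)
    (hε : (n : ℝ) * ρ ^ 2 = ε ^ 2) (hL : 0 ≤ L) :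
    (Measure.pi fun _ : Fin n => μ₀).real {x | ε * L ≤ ∑ t, f (x t)} ≤ Real.exp (-L ^ 2 / 2) := by
  have hsub : ∀ t ∈ (Finset.univ : Finset (Fin n)), ProbabilityTheory.HasSubgaussianMGF
      (fun x : Fin n → Ω => f (x t)) ((‖ρ - -ρ‖₊ / 2) ^ 2) (Measure.pi fun _ : Fin n => μ₀) :=
    fun t _ => by
      refine ProbabilityTheory.hasSubgaussianMGF_of_mem_Icc_of_integral_eq_zero
        (hfm.comp (measurable_pi_apply t)).aemeasurable
        (ae_of_all _ fun x => abs_le.1 (hf (x t))) ?_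
      exact (integral_comp_eval (μ := fun _ : Fin n => μ₀) (i := t)
        hfm.aestronglyMeasurable).trans hf0
  have h := ProbabilityTheory.HasSubgaussianMGF.measure_sum_ge_le_of_iIndepFun
    (ProbabilityTheory.iIndepFun_pi (μ := fun _ : Fin n => μ₀) (X := fun _ => f)
      fun _ => hfm.aemeasurable) hsub (by positivity : 0 ≤ ε * L)
  refine h.trans (le_of_eq ?_)
  congr 1
  have hc : (((‖ρ - -ρ‖₊ / 2) ^ 2 : NNReal) : ℝ) = ρ ^ 2 := by
    push_cast
    rw [Real.norm_eq_abs, sub_neg_eq_add, abs_of_pos (by linarith)]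
    ring
  push_cast at hc ⊢
  rw [Finset.sum_const, Finset.card_univ, Fintype.card_fin, nsmul_eq_mul, hc, hε]
  field_simp

theorem measureReal_likelihood_deviates_le {Ω : Type*} [MeasurableSpace Ω] {n : ℕ}
    (μ₀ : Measure Ω) [IsProbabilityMeasure μ₀] {ρ ε L : ℝ} {f : Ω → ℝ} (hfm : Measurable f)
    (hf : ∀ a, |f a| ≤ ρ) (hf0 : ∫ a, f a ∂μ₀ = 0) (hρ0 : 0 < ρ) (hρ : ρ ≤ 1 / 4) (hε0 : 0 < ε)
    (hε : (n : ℝ) * ρ ^ 2 = ε ^ 2) (hL : 2 * ε ≤ L) (hεL : ε * L ≤ 1) :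
    (Measure.pi fun _ : Fin n => μ₀).real {x | 2 * ε * L < |∏ t, (1 + f (x t)) - 1|} ≤
      2 * Real.exp (-L ^ 2 / 2) := by
  have h1 := measureReal_sum_ge_le μ₀ hfm hf hf0 hρ0 hε0 hε (by linarith : 0 ≤ L)
  have h2 := measureReal_sum_ge_le μ₀ (f := fun a => -f a) hfm.neg
    (fun a => by rw [abs_neg]; exact hf a) (by rw [integral_neg, hf0, neg_zero]) hρ0 hε0 hε
    (by linarith : 0 ≤ L)
  have hsub : {x : Fin n → Ω | 2 * ε * L < |∏ t, (1 + f (x t)) - 1|} ⊆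
      {x | ε * L ≤ ∑ t, f (x t)} ∪ {x | ε * L ≤ ∑ t, -f (x t)} := by
    intro x hx
    by_contra hcon
    simp only [Set.mem_union, Set.mem_ofPred_eq, not_or, not_le, Finset.sum_neg_distrib] at hcon hx
    have := abs_prod_one_add_sub_one_le (fun t => f (x t)) (fun t => hf _) hρ hε0 hε hL hεL
      (abs_le.2 ⟨by linarith, by linarith⟩)
    linarith
  have := (measureReal_mono hsub).trans (measureReal_union_le (μ := Measure.pi fun _ : Fin n => μ₀)
    _ _)
  linarith

/-- Change of measure by second moments: the likelihood ratio H satisfies H ≤ δH²/4 + 1/δ, and E H²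
≤ (1 + ρ²)^n ≤ 2. -/
theorem measureReal_pi_le_of_sq {Ω : Type*} [MeasurableSpace Ω] {n : ℕ} (μ₀ μ : Measure Ω)
    [IsProbabilityMeasure μ₀] [IsProbabilityMeasure μ] {ρ ε δ : ℝ} {f : Ω → ℝ}
    (hfm : Measurable f) (hf : ∀ a, |f a| ≤ ρ) (hf0 : ∫ a, f a ∂μ₀ = 0) (hρ : ρ ≤ 1 / 4)
    (hμ : μ = μ₀.withDensity fun a => ENNReal.ofReal (1 + f a))
    (hε : (n : ℝ) * ρ ^ 2 = ε ^ 2) (hε1 : ε ^ 2 ≤ 1 / 16) (hδ : 0 < δ) {A : Set (Fin n → Ω)}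
    (hA : MeasurableSet A) (hA0 : (Measure.pi fun _ : Fin n => μ₀).real A ≤ δ ^ 2 / 2) :
    (Measure.pi fun _ : Fin n => μ).real A ≤ δ := by
  have hfi : Integrable f μ₀ := integrable_of_abs_le hfm hf
  have hg0 : ∀ a, 0 ≤ 1 + f a := fun a => by have := abs_le.1 (hf a); linarith
  have hgi : Integrable (fun a => 1 + f a) μ₀ := (integrable_const _).add hfi
  have hsq : ∀ a, f a ^ 2 ≤ ρ ^ 2 := fun a => by
    have := abs_le.1 (hf a); exact sq_le_sq' this.1 this.2
  have hf2i : Integrable (fun a => f a ^ 2) μ₀ := integrable_of_abs_le (hfm.pow_const 2)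
    (C := ρ ^ 2) fun a => by rw [abs_of_nonneg (sq_nonneg _)]; exact hsq a
  have hg2i : Integrable (fun a => (1 + f a) ^ 2) μ₀ := by
    have : (fun a => (1 + f a) ^ 2) = fun a => 1 + 2 * f a + f a ^ 2 := by ext a; ring
    rw [this]
    exact ((integrable_const _).add (hfi.const_mul 2)).add hf2i
  have hg2 : ∫ a, (1 + f a) ^ 2 ∂μ₀ ≤ 1 + ρ ^ 2 := by
    have e : ∀ a, (1 + f a) ^ 2 = (1 + 2 * f a) + f a ^ 2 := fun a => by ring
    simp_rw [e]
    have h2i : Integrable (fun a => 1 + 2 * f a) μ₀ := (integrable_const _).add (hfi.const_mul 2)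
    rw [integral_add h2i hf2i,
      integral_add (integrable_const _) (hfi.const_mul 2), integral_const_mul, hf0]
    have : ∫ a, f a ^ 2 ∂μ₀ ≤ ∫ _a, ρ ^ 2 ∂μ₀ := integral_mono hf2i (integrable_const _) hsq
    simp at this ⊢
    linarith
  set M := Measure.pi fun _ : Fin n => μ₀
  have hH : Integrable (fun x : Fin n → Ω => ∏ t, (1 + f (x t))) M :=
    Integrable.fintype_prod fun t => hgi
  have hH2 : Integrable (fun x : Fin n → Ω => ∏ t, (1 + f (x t)) ^ 2) M :=
    Integrable.fintype_prod (f := fun _ a => (1 + f a) ^ 2) fun t => hg2i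
  have hH2le : ∫ x, ∏ t, (1 + f (x t)) ^ 2 ∂M ≤ 2 := by
    rw [integral_fintype_prod_eq_prod (f := fun _ a => (1 + f a) ^ 2), Finset.prod_const,
      Finset.card_univ, Fintype.card_fin]
    calc _ ≤ (1 + ρ ^ 2) ^ n := pow_le_pow_left₀ (integral_nonneg fun a => sq_nonneg _) hg2 n
      _ ≤ (Real.exp (ρ ^ 2)) ^ n := pow_le_pow_left₀ (by positivity)
          (by linarith [Real.add_one_le_exp (ρ ^ 2)]) n
      _ = Real.exp (ε ^ 2) := by rw [← Real.exp_nat_mul, hε]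
      _ ≤ 2 := by
          have := (abs_le.1 (Real.abs_exp_sub_one_sub_id_le (x := ε ^ 2)
            (by rw [abs_of_nonneg (sq_nonneg _)]; linarith))).2
          nlinarith [sq_nonneg ε]
  rw [measureReal_pi_eq_setIntegral μ₀ μ hgi hg0 hμ hA]
  calc ∫ x in A, ∏ t, (1 + f (x t)) ∂M
      ≤ ∫ x in A, (δ / 4 * ∏ t, (1 + f (x t)) ^ 2 + 1 / δ) ∂M := by
        refine setIntegral_mono hH.integrableOn
          (((hH2.const_mul _).add (integrable_const _)).integrableOn) fun x => ?_
        simp only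
        rw [Finset.prod_pow]
        have : δ / 4 * (∏ t, (1 + f (x t))) ^ 2 + 1 / δ - ∏ t, (1 + f (x t)) =
            (δ / 2 * ∏ t, (1 + f (x t)) - 1) ^ 2 / δ := by field_simp; ring
        have h2 : 0 ≤ (δ / 2 * ∏ t, (1 + f (x t)) - 1) ^ 2 / δ := by positivity
        linarith
    _ = δ / 4 * ∫ x in A, ∏ t, (1 + f (x t)) ^ 2 ∂M + M.real A / δ := by
        rw [integral_add (hH2.const_mul _).integrableOn (integrable_const _), integral_const_mul,
          setIntegral_const, smul_eq_mul]
        ring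
    _ ≤ δ / 4 * 2 + δ ^ 2 / 2 / δ := by
        gcongr
        exact (setIntegral_le_integral hH2 (ae_of_all _ fun x =>
          Finset.prod_nonneg fun t _ => sq_nonneg _)).trans hH2le
    _ = δ := by field_simp; norm_num

/-! ### Identification from samples of a centered family -/

theorem integral_eq_zero_of_withDensity {Ω : Type*} [MeasurableSpace Ω] (μ₀ μ : Measure Ω)
    [IsProbabilityMeasure μ₀] [IsProbabilityMeasure μ] {f : Ω → ℝ} (hfi : Integrable f μ₀)
    (hf : ∀ a, 0 ≤ 1 + f a) (hμ : μ = μ₀.withDensity fun a => ENNReal.ofReal (1 + f a)) :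
    ∫ a, f a ∂μ₀ = 0 := by
  have hgi : Integrable (fun a => 1 + f a) μ₀ := (integrable_const _).add hfi
  have h1 : ENNReal.ofReal (∫ a, (1 + f a) ∂μ₀) = 1 := by
    rw [ofReal_integral_eq_lintegral_ofReal hgi (ae_of_all _ hf), ← setLIntegral_univ,
      ← withDensity_apply _ MeasurableSet.univ, ← hμ, measure_univ]
  rw [ENNReal.ofReal_eq_one, integral_add (integrable_const _) hfi] at h1
  simpa using h1

theorem sq_div_mul_one_add_sub_one_le {a b δ : ℝ} (hδ : δ ≤ 1 / 4) (ha : 1 - δ ≤ a) (ha1 : a ≤ 1)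
    (hb : 1 - δ ≤ b) (hb1 : b ≤ 1) (z : ℝ) :
    (a / b * (1 + z) - 1) ^ 2 ≤ 4 * z ^ 2 + 8 * δ ^ 2 := by
  have hb0 : 0 < b := by linarith
  obtain ⟨α, hα⟩ : ∃ α, α = a / b := ⟨_, rfl⟩
  rw [← hα]
  have hαb : α * b = a := by rw [hα]; field_simp
  have h1 : α ≤ 1 + 2 * δ := by
    rw [hα, div_le_iff₀ hb0]
    nlinarith
  have h0 : 1 - δ ≤ α := by
    rw [hα, le_div_iff₀ hb0]
    nlinarith
  have h43 : α ≤ 4 / 3 := by rw [hα, div_le_iff₀ hb0]; linarith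
  have h2 : α ^ 2 ≤ 2 := by nlinarith
  have h3 : (α - 1) ^ 2 ≤ 4 * δ ^ 2 := by nlinarith
  calc (α * (1 + z) - 1) ^ 2 ≤ 2 * (α ^ 2 * z ^ 2) + 2 * (α - 1) ^ 2 := by
        nlinarith [sq_nonneg (α * z - (α - 1))]
    _ ≤ 2 * (2 * z ^ 2) + 2 * (4 * δ ^ 2) := by gcongr
    _ = _ := by ring

theorem sum_success_centered_le {Ω Λ : Type*} [MeasurableSpace Ω] [Fintype Λ] {m n k B : ℕ}
    (hn : 1 ≤ n) (μ₀ : Measure Ω) (μ : Fin k → Measure Ω) [IsProbabilityMeasure μ₀]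
    [∀ i, IsProbabilityMeasure (μ i)] {ρ ε L δ : ℝ} (F : Fin k → Ω → ℝ)
    (hFm : ∀ i, Measurable (F i)) (hF : ∀ i a, |F i a| ≤ ρ)
    (hμ : ∀ i, μ i = μ₀.withDensity fun a => ENNReal.ofReal (1 + F i a))
    (hρ0 : 0 < ρ) (hρ : ρ ≤ 1 / 4) (hε0 : 0 < ε) (hε : (n : ℝ) * ρ ^ 2 = ε ^ 2)
    (hε' : ε ≤ 1 / 4)
    (hcorr : ∑ T : Finset (Fin k), (ε ^ T.card)⁻¹ * |∫ a, ∏ i ∈ T, F i a ∂μ₀| ≤ 1 + 1 / n)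
    (hL : 16 ≤ L) (hεL : ε * L ≤ 1 / 4) (hδ0 : 0 < δ) (hδ1 : δ ≤ 1 / 4)
    (hδk : k * δ ^ 2 ≤ ε ^ 2) (htail : k * (2 * Real.exp (-(L / 2) ^ 2 / 2)) ≤ δ ^ 2 / 2)
    (P : RectanglePartition m B (Fin n → Ω) Λ) (out : Λ → Fin k) :
    ∑ i, ∑ l with out l = i, P.mass (Measure.pi fun _ : Fin n => μ i) l ≤
      1 + 24 * (k * (B * δ) + 8 * ε ^ 2 * L ^ 2 * (Real.log (Fintype.card Λ) + 3 * B))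
        + k / 12 := by
  have hFi : ∀ i, Integrable (F i) μ₀ := fun i => integrable_of_abs_le (hFm i) (hF i)
  have hg0 : ∀ i a, 0 ≤ 1 + F i a := fun i a => by have := abs_le.1 (hF i a); linarith
  have hgi : ∀ i, Integrable (fun a => 1 + F i a) μ₀ := fun i => (integrable_const _).add (hFi i)
  have hF0 : ∀ i, ∫ a, F i a ∂μ₀ = 0 := fun i =>
    integral_eq_zero_of_withDensity μ₀ (μ i) (hFi i) (hg0 i) (hμ i)
  set M₀ := Measure.pi fun _ : Fin n => μ₀ with hM₀
  set M : Fin k → Measure (Fin n → Ω) := fun i => Measure.pi fun _ : Fin n => μ i with hM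
  set H : Fin k → (Fin n → Ω) → ℝ := fun i x => ∏ t, (1 + F i (x t)) with hH
  have hHm : ∀ i, Measurable (H i) := fun i =>
    Finset.measurable_fun_prod _ fun t _ => ((hFm i).comp (measurable_pi_apply t)).const_add 1
  have hHi : ∀ i, Integrable (H i) M₀ := fun i => Integrable.fintype_prod fun t => hgi i
  have hMH : ∀ i {E}, MeasurableSet E → (M i).real E = ∫ x in E, H i x ∂M₀ := fun i E hE =>
    measureReal_pi_eq_setIntegral μ₀ (μ i) (hgi i) (hg0 i) (hμ i) hE
  set Y : Fin k → (Fin n → Ω) → ℝ := fun i x => (H i x - 1) / ε with hY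
  have hYm : ∀ i, Measurable (Y i) := fun i => ((hHm i).sub_const 1).div_const ε
  have hHY : ∀ i x, H i x = 1 + ε * Y i x := fun i x => by simp only [hY]; field_simp; ring
  -- All k ratios are controlled at once, so that one conditioning event serves every hypothesis.
  set G : Set (Fin n → Ω) := {x | ∀ i, |H i x - 1| ≤ ε * L} with hGdef
  have hG : MeasurableSet G := by
    rw [hGdef, Set.ofPred_forall]
    exact MeasurableSet.iInter fun i =>
      measurableSet_le ((hHm i).sub_const 1).abs measurable_const
  have hYG : ∀ i, ∀ x ∈ G, |Y i x| ≤ L := fun i x hx => by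
    rw [hY, abs_div, abs_of_pos hε0, div_le_iff₀ hε0, mul_comm L]
    exact hx i
  have hε2 : ε ^ 2 ≤ 1 / 16 := by nlinarith
  have hGc₀ : M₀.real Gᶜ ≤ δ ^ 2 / 2 := by
    have hsub : Gᶜ ⊆ ⋃ i ∈ (Finset.univ : Finset (Fin k)),
        {x | 2 * ε * (L / 2) < |∏ t, (1 + F i (x t)) - 1|} := by
      intro x hx
      simp only [hGdef, Set.mem_compl_iff, Set.mem_ofPred_eq, not_forall, not_le] at hx
      obtain ⟨i, hi⟩ := hx
      refine Set.mem_iUnion₂.2 ⟨i, Finset.mem_univ _, ?_⟩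
      rw [Set.mem_ofPred_eq]
      have : 2 * ε * (L / 2) = ε * L := by ring
      rw [this]
      exact hi
    refine ((measureReal_mono hsub (measure_ne_top _ _)).trans
      (measureReal_biUnion_finset_le _ _)).trans (le_trans ?_ htail)
    calc _ ≤ ∑ _i : Fin k, 2 * Real.exp (-(L / 2) ^ 2 / 2) := Finset.sum_le_sum fun i _ =>
          measureReal_likelihood_deviates_le μ₀ (hFm i) (hF i) (hF0 i) hρ0 hρ hε0 hε
            (by linarith) (by nlinarith)
      _ = _ := by simp
  have hGc : ∀ i, (M i).real Gᶜ ≤ δ := fun i =>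
    measureReal_pi_le_of_sq μ₀ (μ i) (hFm i) (hF i) (hF0 i) hρ (hμ i) hε hε2 hδ0 hG.compl hGc₀
  have hG₀ : 1 - δ ≤ M₀.real G := by
    have := probReal_compl_eq_one_sub (μ := M₀) hG
    nlinarith
  have hGi : ∀ i, 1 - δ ≤ (M i).real G := fun i => by
    have := probReal_compl_eq_one_sub (μ := M i) hG
    linarith [hGc i]
  have hK0 : 0 ≤ 8 * ε ^ 2 * L ^ 2 := by positivity
  refine sum_success_le P M₀ M hG hδ0.le hδ1 hG₀ hGi ?_ ?_ hK0 ?_ out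
  · intro i E hE h0
    rw [hMH i hE]
    exact setIntegral_measure_zero _ ((measureReal_eq_zero_iff).1 h0)
  · intro i E hE
    have hlow : (1 - ε * L) * M₀.real (G ∩ E) ≤ (M i).real (G ∩ E) := by
      rw [hMH i (hG.inter hE)]
      have : ∫ x in G ∩ E, (1 - ε * L) ∂M₀ ≤ ∫ x in G ∩ E, H i x ∂M₀ := by
        refine setIntegral_mono_on (integrable_const _) (hHi i).integrableOn (hG.inter hE)
          fun x hx => ?_
        have := (abs_le.1 (hx.1 i)).1
        linarith
      rwa [setIntegral_const, smul_eq_mul, mul_comm] at this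
    rw [measureReal_cond_apply hG, measureReal_cond_apply hG]
    have hG1 : (M i).real G ≤ 1 := measureReal_le_one
    have hGpos : 0 < (M i).real G := by linarith [hGi i]
    have h1 : (1 : ℝ) ≤ ((M i).real G)⁻¹ := (one_le_inv₀ hGpos).2 hG1
    have h2 : (M₀.real G)⁻¹ ≤ 4 / 3 := by
      rw [inv_le_comm₀ (by linarith) (by norm_num)]; linarith
    have hq : 0 ≤ M₀.real (G ∩ E) := measureReal_nonneg
    have hq' : 0 ≤ (M i).real (G ∩ E) := measureReal_nonneg
    calc 1 / 2 * ((M₀.real G)⁻¹ * M₀.real (G ∩ E)) ≤ 1 / 2 * (4 / 3 * M₀.real (G ∩ E)) := by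
          gcongr
      _ ≤ (1 - ε * L) * M₀.real (G ∩ E) := by nlinarith
      _ ≤ (M i).real (G ∩ E) := hlow
      _ ≤ ((M i).real G)⁻¹ * (M i).real (G ∩ E) := by nlinarith
  · intro E hE hpos
    set p := M₀.real (G ∩ E) with hp
    have hG₀pos : 0 < M₀.real G := by linarith
    have hGipos : ∀ i, 0 < (M i).real G := fun i => by linarith [hGi i]
    have hqeq : (ProbabilityTheory.cond M₀ G).real E = (M₀.real G)⁻¹ * p :=
      measureReal_cond_apply hG _ _
    have hppos : 0 < p := by
      rw [hqeq] at hpos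
      exact pos_of_mul_pos_right hpos (inv_nonneg.2 hG₀pos.le)
    have hlevel := sum_sq_average_le M₀ Y hYm (fun c hc => by
      obtain ⟨hwi, hw1⟩ := integrable_and_integral_prod_tiltWeight_le hn μ₀ F hFm hF hε0 hε'
        hcorr c hc
      refine ⟨_, hwi, fun x => Finset.prod_nonneg fun i _ => tiltWeight_nonneg _
        (fun t => hF i (x t)) hρ hε0 hε hε' (hc i), hw1, fun x hx => ?_⟩
      rw [Real.exp_sum]
      exact Finset.prod_le_prod (fun i _ => (Real.exp_pos _).le) fun i _ =>
        exp_le_tiltWeight _ (fun t => hF i (x t)) hρ hε0 hε hε' (hHY i x) (hc i) (hx i)) hL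
      (hG.inter hE) (fun i x hx => hYG i x hx.1) hppos
    set y : Fin k → ℝ := fun i => (∫ x in G ∩ E, Y i x ∂M₀) / p with hy
    have hMi : ∀ i, (M i).real (G ∩ E) = p * (1 + ε * y i) := fun i => by
      have hYi : Integrable (Y i) M₀ := ((hHi i).sub (integrable_const 1)).div_const ε
      rw [hMH i (hG.inter hE)]
      simp_rw [hHY i]
      rw [integral_add (integrable_const _) (hYi.integrableOn.const_mul ε), integral_const_mul,
        setIntegral_const, smul_eq_mul, mul_one, hy]
      field_simp
      rfl
    have hterm : ∀ i, ((ProbabilityTheory.cond (M i) G).real E /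
        (ProbabilityTheory.cond M₀ G).real E - 1) ^ 2 ≤
        4 * ε ^ 2 * y i ^ 2 + 8 * δ ^ 2 := fun i => by
      rw [hqeq, measureReal_cond_apply hG, hMi i]
      have e : ((M i).real G)⁻¹ * (p * (1 + ε * y i)) / ((M₀.real G)⁻¹ * p) =
          M₀.real G / (M i).real G * (1 + ε * y i) := by
        have := (hGipos i).ne'
        field_simp
      rw [e]
      have := sq_div_mul_one_add_sub_one_le hδ1 hG₀ measureReal_le_one (hGi i) measureReal_le_one
        (ε * y i)
      rwa [mul_pow, ← mul_assoc] at this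
    have hlog : -1 ≤ Real.log (M₀.real G) := by
      rw [Real.le_log_iff_exp_le hG₀pos]
      have h2 : (2 : ℝ) ≤ Real.exp 1 := by linarith [Real.add_one_le_exp (1 : ℝ)]
      have : Real.exp (-1) ≤ 1 / 2 := by
        rw [Real.exp_neg, one_div]; exact inv_anti₀ (by norm_num) h2
      linarith
    have hlogq : Real.log ((ProbabilityTheory.cond M₀ G).real E) =
        Real.log p - Real.log (M₀.real G) := by
      rw [hqeq, Real.log_mul (inv_ne_zero hG₀pos.ne') hppos.ne', Real.log_inv]; ring
    -- The constant 3 collects 1 from the level-one inequality, 1 from −log M₀(G) ≤ 1, and 1 from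
    -- the normalisation error 8kδ² ≤ 8ε² ≤ 8ε²L².
    refine (Finset.sum_le_sum fun i _ => hterm i).trans ?_
    rw [Finset.sum_add_distrib, ← Finset.mul_sum, hlogq]
    simp only [Finset.sum_const, Finset.card_univ, Fintype.card_fin, nsmul_eq_mul]
    have h1 := mul_le_mul_of_nonneg_left hlevel (by positivity : 0 ≤ 4 * ε ^ 2)
    have h2 : 8 * ε ^ 2 ≤ 8 * ε ^ 2 * L ^ 2 := by
      have : 1 ≤ L ^ 2 := by nlinarith
      nlinarith [sq_nonneg ε]
    have h3 := mul_le_mul_of_nonneg_left hlog hK0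
    nlinarith

/-! ### From protocols to rectangle partitions -/

namespace Protocol

variable {m k : ℕ} {X R : Type*} [MeasurableSpace X] [MeasurableSpace R]

/-- The partition of the inputs according to the transcript of a protocol that sends at most `B`
bits. -/
def transcriptPartition (π : Protocol m k X R) {B : ℕ}
    (hB : ∀ r x t, (π.history r x t).length ≤ B) (r : R) :
    RectanglePartition m B X (Set.range fun x => π.history r x B) where
  side l j := π.consistent r l j
  measurableSet_side l j := π.measurableSet_consistent r l j
  -- Uniqueness relies on the labels being realised transcripts.
  existsUnique x := by
    refine ⟨⟨_, x, rfl⟩, fun j => π.mem_consistent_history r x B j, ?_⟩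
    rintro ⟨_, x', rfl⟩ h
    exact Subtype.ext (π.history_eq_of_mem_consistent r x x' B h).symm
  support l := π.speakers r l
  card_support_le l := by
    obtain ⟨_, x, rfl⟩ := l
    exact (π.card_speakers_le r _).trans (hB r x B)
  side_eq_univ _ _ hj := π.consistent_eq_univ hj

theorem finite_range_history (π : Protocol m k X R) {B : ℕ}
    (hB : ∀ r x t, (π.history r x t).length ≤ B) (r : R) :
    (Set.range fun x => π.history r x B).Finite :=
  (List.finite_length_le Bool B).subset (by rintro _ ⟨x, rfl⟩; exact hB r x B)

theorem card_range_history_le (π : Protocol m k X R) {B : ℕ}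
    (hB : ∀ r x t, (π.history r x t).length ≤ B) (r : R)
    [Fintype (Set.range fun x => π.history r x B)] :
    Fintype.card (Set.range fun x => π.history r x B) ≤ 2 ^ (B + 1) := by
  rw [← Set.toFinset_card]
  refine card_lists_le B _ fun h hh => ?_
  obtain ⟨x, rfl⟩ := Set.mem_toFinset.1 hh
  exact hB r x B

/-- The bound holds for each fixed seed, hence survives averaging over shared randomness. -/
theorem sum_measureReal_output_le (π : Protocol m k X R) {B : ℕ}
    (hB : ∀ r x t, (π.history r x t).length ≤ B) (M : Fin k → Measure X)
    [∀ i, IsProbabilityMeasure (M i)] {b : ℝ} (hb0 : 0 ≤ b)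
    (hb : ∀ (r : R) [Fintype (Set.range fun x => π.history r x B)]
      (out : (Set.range fun x => π.history r x B) → Fin k),
      ∑ i, ∑ l with out l = i, (π.transcriptPartition hB r).mass (M i) l ≤ b) :
    ∑ i, (π.coins.prod (Measure.pi fun _ : Fin m => M i)).real {p | π.Outputs p.1 p.2 i} ≤ b := by
  have := π.prob_coins
  have hset : ∀ i, {p : R × (Fin m → X) | π.Outputs p.1 p.2 i} =
      {p | π.output p.1 (π.history p.1 p.2 B) = i} := fun i => by
    ext p; exact π.outputs_iff hB p.1 p.2 i
  have hslice : ∀ r, ∑ i, (Measure.pi fun _ : Fin m => M i)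
      {x | π.output r (π.history r x B) = i} ≤ ENNReal.ofReal b := fun r => by
    have := (π.finite_range_history hB r).fintype
    set out : (Set.range fun x => π.history r x B) → Fin k := fun l => π.output r l with hout
    have h1 := hb r out
    have h2 : ∀ i, ∑ l with out l = i, (π.transcriptPartition hB r).mass (M i) l =
        (Measure.pi fun _ : Fin m => M i).real
          {x | π.output r (π.history r x B) = i} := fun i => by
      refine ((π.transcriptPartition hB r).sum_prod_eq (fun _ => M i) _).trans ?_
      congr 1
      ext x
      simp only [Finset.mem_filter, Finset.mem_univ, true_and, Set.mem_ofPred_eq]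
      constructor
      · rintro ⟨⟨_, x', rfl⟩, hl, hx⟩
        rw [π.history_eq_of_mem_consistent r x x' B hx]
        exact hl
      · intro h
        exact ⟨⟨_, x, rfl⟩, h, fun j => π.mem_consistent_history r x B j⟩
    simp_rw [h2] at h1
    calc _ = ∑ i, ENNReal.ofReal ((Measure.pi fun _ : Fin m => M i).real
            {x | π.output r (π.history r x B) = i}) :=
          Finset.sum_congr rfl fun i _ => (ofReal_measureReal).symm
      _ = _ := (ENNReal.ofReal_sum_of_nonneg fun i _ => measureReal_nonneg).symm
      _ ≤ _ := ENNReal.ofReal_le_ofReal h1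
  have hsum : ∑ i, (π.coins.prod (Measure.pi fun _ : Fin m => M i))
      {p | π.output p.1 (π.history p.1 p.2 B) = i} ≤ ENNReal.ofReal b := by
    have h1 : ∀ i, (π.coins.prod (Measure.pi fun _ : Fin m => M i))
        {p | π.output p.1 (π.history p.1 p.2 B) = i} =
        ∫⁻ r, (Measure.pi fun _ : Fin m => M i) {x | π.output r (π.history r x B) = i} ∂π.coins :=
      fun i => Measure.prod_apply (π.measurableSet_output_history B i)
    simp_rw [h1]
    have h2 : ∀ i, Measurable fun r => (Measure.pi fun _ : Fin m => M i)
        {x | π.output r (π.history r x B) = i} := fun i =>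
      measurable_measure_prodMk_left (π.measurableSet_output_history B i)
    rw [← lintegral_finsetSum _ fun i _ => h2 i]
    refine (lintegral_mono hslice).trans ?_
    simp
  simp_rw [hset]
  have h3 := ENNReal.toReal_mono ENNReal.ofReal_ne_top hsum
  rwa [ENNReal.toReal_ofReal hb0, ENNReal.toReal_sum fun i _ => measure_ne_top _ _] at h3

end Protocol

/-! ### Reformulations of the correlation condition -/

theorem rpow_mul_rpow_eq_inv_pow {n : ℕ} {ρ : ℝ} (hρ : 0 < ρ) (hn : 1 ≤ n) (s : ℕ) :
    (n : ℝ) ^ (-(s : ℝ) / 2) * ρ ^ (-(s : ℝ)) = ((√n * ρ) ^ s)⁻¹ := by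
  have hn0 : (0 : ℝ) < n := by exact_mod_cast hn
  rw [mul_pow, mul_inv, Real.rpow_neg hρ.le, Real.rpow_natCast, neg_div, Real.rpow_neg hn0.le,
    Real.sqrt_eq_rpow, ← Real.rpow_natCast ((n : ℝ) ^ _), ← Real.rpow_mul hn0.le]
  congr 3
  ring

theorem corrTerm_eq {Ω : Type*} [MeasurableSpace Ω] {k n : ℕ} (hn : 1 ≤ n) {ρ : ℝ} (hρ : 0 < ρ)
    (μ₀ : Measure Ω) (μ : Fin k → Measure Ω) (F : Fin k → Ω → ℝ)
    (hF : ∀ i, (fun a => ((μ i).rnDeriv μ₀ a).toReal - 1) =ᵐ[μ₀] F i) (S : Finset (Fin k)) :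
    corrTerm n ρ μ₀ μ S = ((√n * ρ) ^ S.card)⁻¹ * |∫ a, ∏ i ∈ S, F i a ∂μ₀| := by
  rw [corrTerm, rpow_mul_rpow_eq_inv_pow hρ hn]
  congr 2
  refine integral_congr_ae ?_
  have h : ∀ᵐ a ∂μ₀, ∀ i, ((μ i).rnDeriv μ₀ a).toReal - 1 = F i a := ae_all_iff.2 hF
  filter_upwards [h] with a ha
  exact Finset.prod_congr rfl fun i _ => ha i

/-- The empty set contributes 1, and singletons vanish because the F i have mean zero. -/
theorem CorrCondition.sum_le {Ω : Type*} [MeasurableSpace Ω] {k n : ℕ} (hn : 1 ≤ n) {ρ : ℝ}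
    (hρ : 0 < ρ) (μ₀ : Measure Ω) [IsProbabilityMeasure μ₀] (μ : Fin k → Measure Ω)
    (F : Fin k → Ω → ℝ) (hF : ∀ i, (fun a => ((μ i).rnDeriv μ₀ a).toReal - 1) =ᵐ[μ₀] F i)
    (hF0 : ∀ i, ∫ a, F i a ∂μ₀ = 0) (h : CorrCondition n ρ μ₀ μ) :
    ∑ T : Finset (Fin k), ((√n * ρ) ^ T.card)⁻¹ * |∫ a, ∏ i ∈ T, F i a ∂μ₀| ≤ 1 + 1 / n := by
  rw [← Finset.sum_filter_add_sum_filter_not Finset.univ (fun T : Finset (Fin k) => 2 ≤ T.card),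
    add_comm]
  refine add_le_add ?_ ?_
  · rw [Finset.sum_eq_single_of_mem (∅ : Finset (Fin k)) (by simp)]
    · simp
    · intro T hT hne
      have h1 : T.card = 1 := by
        have h2 := (Finset.mem_filter.1 hT).2
        have h3 := Finset.card_pos.2 (Finset.nonempty_iff_ne_empty.2 hne)
        omega
      obtain ⟨i, rfl⟩ := Finset.card_eq_one.1 h1
      simp [hF0]
  · refine le_trans (le_of_eq ?_) h
    exact Finset.sum_congr rfl fun S _ => (corrTerm_eq hn hρ μ₀ μ F hF S).symm

/-- Since |F i| ≤ ρ, each term is at most n^(−|S|/2). For |S| > ℓ the size of n makes this at most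
k^(−|S|)/n, and these bounds sum binomially. -/
theorem corrCondition_of_vanishing {Ω : Type*} [MeasurableSpace Ω] {k n ℓ : ℕ} (hn : 1 ≤ n)
    {ρ : ℝ} {μ₀ : Measure Ω} {μ : Fin k → Measure Ω} (h : IsCenteredFamily ρ μ₀ μ) (hℓ : 2 ≤ ℓ)
    (hvan : ∀ S : Finset (Fin k), 2 ≤ S.card → S.card ≤ ℓ → corrTerm n ρ μ₀ μ S = 0)
    (hk : (k : ℝ) ^ (2 * ((ℓ : ℝ) + 1) / ((ℓ : ℝ) - 1)) ≤ n) : CorrCondition n ρ μ₀ μ := by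
  obtain ⟨F, hFm, hF, hFae, -⟩ := h.exists_density
  have := h.prob_center
  have hρ := h.rho_pos
  have hn0 : (0 : ℝ) < n := by exact_mod_cast hn
  have hk2 : (2 : ℝ) ≤ k := by exact_mod_cast h.two_le
  have hk0 : (0 : ℝ) < k := by linarith
  have hℓ2 : (2 : ℝ) ≤ ℓ := by exact_mod_cast hℓ
  have hterm : ∀ S : Finset (Fin k), corrTerm n ρ μ₀ μ S ≤ ((√n) ^ S.card)⁻¹ := fun S => by
    rw [corrTerm_eq hn hρ μ₀ μ F hFae, mul_pow, mul_inv, mul_assoc]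
    refine mul_le_of_le_one_right (by positivity) ?_
    rw [inv_mul_le_iff₀ (by positivity), mul_one]
    have := norm_integral_le_of_norm_le_const (μ := μ₀) (f := fun a => ∏ i ∈ S, F i a)
      (C := ρ ^ S.card) (ae_of_all _ fun a => by
        rw [Real.norm_eq_abs, Finset.abs_prod, ← Finset.prod_const]
        exact Finset.prod_le_prod (fun _ _ => abs_nonneg _) fun i _ => hF i a)
    simpa using this
  have hkey : (k : ℝ) ^ (ℓ + 1) * n ≤ (√n) ^ (ℓ + 1) := by
    have h1 := Real.rpow_le_rpow (by positivity) hk (by linarith : 0 ≤ ((ℓ : ℝ) - 1) / 2)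
    rw [← Real.rpow_mul hk0.le] at h1
    have e1 : 2 * ((ℓ : ℝ) + 1) / ((ℓ : ℝ) - 1) * (((ℓ : ℝ) - 1) / 2) = ((ℓ + 1 : ℕ) : ℝ) := by
      have : (ℓ : ℝ) - 1 ≠ 0 := by linarith
      push_cast; field_simp
    rw [e1, Real.rpow_natCast] at h1
    have e2 : (√n) ^ (ℓ + 1) = (n : ℝ) ^ (((ℓ : ℝ) - 1) / 2) * n := by
      conv_rhs => rw [← Real.rpow_one (n : ℝ), ← Real.rpow_mul hn0.le, ← Real.rpow_add hn0]
      rw [Real.sqrt_eq_rpow, ← Real.rpow_natCast, ← Real.rpow_mul hn0.le]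
      congr 1; push_cast; ring
    rw [e2]
    exact mul_le_mul_of_nonneg_right h1 hn0.le
  have hk1 : (k : ℝ) ≤ √n := by
    have h1 : (k : ℝ) ^ (ℓ + 1) ≤ (√n) ^ (ℓ + 1) := by
      refine le_trans ?_ hkey
      have : (1 : ℝ) ≤ n := by exact_mod_cast hn
      exact le_mul_of_one_le_right (by positivity) this
    exact le_of_pow_le_pow_left₀ (by omega) (Real.sqrt_nonneg _) h1
  have hterm2 : ∀ S : Finset (Fin k), 2 ≤ S.card →
      corrTerm n ρ μ₀ μ S ≤ 1 / n * ∏ _i ∈ S, (k : ℝ)⁻¹ := fun S hS => by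
    by_cases hc : S.card ≤ ℓ
    · rw [hvan S hS hc]; positivity
    · refine (hterm S).trans ?_
      rw [Finset.prod_const, inv_pow, one_div, ← mul_inv]
      refine inv_anti₀ (by positivity) ?_
      obtain ⟨d, hd⟩ : ∃ d, S.card = ℓ + 1 + d := ⟨S.card - (ℓ + 1), by omega⟩
      rw [hd, pow_add _ (ℓ + 1) d, pow_add _ (ℓ + 1) d]
      calc (n : ℝ) * (k ^ (ℓ + 1) * k ^ d) = (k ^ (ℓ + 1) * n) * k ^ d := by ring
        _ ≤ √n ^ (ℓ + 1) * √n ^ d := by gcongr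
  have hexp : ∑ S : Finset (Fin k), ∏ _i ∈ S, (k : ℝ)⁻¹ ≤ Real.exp 1 := by
    have h1 : ∏ _i : Fin k, (1 + (k : ℝ)⁻¹) = ∑ S : Finset (Fin k), ∏ _i ∈ S, (k : ℝ)⁻¹ := by
      rw [Finset.prod_one_add, Finset.powerset_univ]
    rw [← h1, Finset.prod_const, Finset.card_univ, Fintype.card_fin]
    calc (1 + (k : ℝ)⁻¹) ^ k ≤ (Real.exp (k : ℝ)⁻¹) ^ k := pow_le_pow_left₀ (by positivity)
          (by linarith [Real.add_one_le_exp (k : ℝ)⁻¹]) k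
      _ = Real.exp 1 := by rw [← Real.exp_nat_mul]; congr 1; field_simp
  -- Sets of size at most 1 carry 1 + k · (1/k) = 2 of a total of at most e, leaving e − 2 < 1.
  have hsmall : (2 : ℝ) ≤
      ∑ S : Finset (Fin k) with ¬ 2 ≤ S.card, ∏ _i ∈ S, (k : ℝ)⁻¹ := by
    have hsub : insert ∅ (Finset.univ.image fun i : Fin k => ({i} : Finset (Fin k))) ⊆
        ({S : Finset (Fin k) | ¬ 2 ≤ S.card} : Finset (Finset (Fin k))) := by
      intro S hS
      rcases Finset.mem_insert.1 hS with rfl | hS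
      · simp
      · obtain ⟨i, -, rfl⟩ := Finset.mem_image.1 hS
        simp
    refine le_trans (le_of_eq ?_) (Finset.sum_le_sum_of_subset_of_nonneg hsub
      fun S _ _ => by positivity)
    rw [Finset.sum_insert (by simp), Finset.sum_image Finset.singleton_injective.injOn]
    simp [hk0.ne']
    norm_num
  rw [CorrCondition]
  have hsplit := Finset.sum_filter_add_sum_filter_not Finset.univ
    (fun T : Finset (Fin k) => 2 ≤ T.card) fun S => ∏ _i ∈ S, (k : ℝ)⁻¹
  calc _ ≤ ∑ S : Finset (Fin k) with 2 ≤ S.card, 1 / (n : ℝ) * ∏ _i ∈ S, (k : ℝ)⁻¹ :=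
        Finset.sum_le_sum fun S hS => hterm2 S (Finset.mem_filter.1 hS).2
    _ = 1 / (n : ℝ) * ∑ S : Finset (Fin k) with 2 ≤ S.card, ∏ _i ∈ S, (k : ℝ)⁻¹ := by
        rw [Finset.mul_sum]
    _ ≤ 1 / (n : ℝ) * 1 := by
        refine mul_le_mul_of_nonneg_left ?_ (by positivity)
        linarith [Real.exp_one_lt_d9]
    _ = 1 / n := mul_one _

/-! ### The main theorem -/

/-- Here log(k/ε²) = log k + 2 log(1/ε) and ε² log(1/ε) ≤ ε, so a hypothesis on log k alone controls
the logarithm of the final bound. -/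
theorem sq_mul_log_div_sq_le {k ε C' : ℝ} (hk : 2 ≤ k) (hε : 0 < ε) (hC' : 1 ≤ C')
    (h : ε ^ 2 * Real.log k ≤ 1 / C' ^ 2) :
    ε ≤ 2 / C' ∧ ε ^ 2 * Real.log (k / ε ^ 2) ≤ 5 / C' := by
  have hlog : 1 / 2 ≤ Real.log k := by
    have := Real.log_le_log (by norm_num) hk
    linarith [Real.log_two_gt_d9]
  have hε1 : ε ≤ 2 / C' := by
    have h1 : ε ^ 2 ≤ (2 / C') ^ 2 := by
      have : ε ^ 2 * (1 / 2) ≤ 1 / C' ^ 2 :=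
        (mul_le_mul_of_nonneg_left hlog (sq_nonneg _)).trans h
      have e : (2 / C') ^ 2 = 4 * (1 / C' ^ 2) := by ring
      have : 0 ≤ 1 / C' ^ 2 := by positivity
      linarith
    exact le_of_pow_le_pow_left₀ two_ne_zero (by positivity) h1
  refine ⟨hε1, ?_⟩
  have hlogε : -Real.log ε ≤ 1 / ε := by
    have := Real.log_le_sub_one_of_pos (inv_pos.2 hε)
    rw [Real.log_inv] at this
    rw [one_div]; linarith
  rw [Real.log_div (by linarith) (by positivity), Real.log_pow]
  have h2 : ε ^ 2 * (-Real.log ε) ≤ ε := by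
    calc ε ^ 2 * (-Real.log ε) ≤ ε ^ 2 * (1 / ε) := mul_le_mul_of_nonneg_left hlogε (sq_nonneg _)
      _ = ε := by field_simp
  have h3 : 1 / C' ^ 2 ≤ 1 / C' := by
    refine one_div_le_one_div_of_le (by positivity) ?_
    nlinarith
  have e : 5 / C' = 1 / C' + 2 * (2 / C') := by ring
  rw [e]
  push_cast
  linarith

theorem sample_size_bound {n : ℕ} {ρ k C' : ℝ} (hn : 1 ≤ n) (hρ : 0 < ρ) (hk : 2 ≤ k)
    (hC' : 0 < C') (h : ρ ≤ ((n : ℝ) * Real.log k) ^ (-(1 / 2 : ℝ)) / C') :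
    (n * ρ ^ 2) * Real.log k ≤ 1 / C' ^ 2 := by
  have hn0 : (0 : ℝ) < n := by exact_mod_cast hn
  have hlog : 0 < Real.log k := Real.log_pos (by linarith)
  have hy : 0 < (n : ℝ) * Real.log k := by positivity
  have h1 : ρ ^ 2 ≤ (((n : ℝ) * Real.log k) ^ (-(1 / 2 : ℝ)) / C') ^ 2 :=
    pow_le_pow_left₀ hρ.le h 2
  have e : (((n : ℝ) * Real.log k) ^ (-(1 / 2 : ℝ))) ^ 2 = ((n : ℝ) * Real.log k)⁻¹ := by
    rw [← Real.rpow_natCast (_ ^ _), ← Real.rpow_mul hy.le, ← Real.rpow_neg_one]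
    norm_num
  rw [div_pow, e] at h1
  calc (n * ρ ^ 2) * Real.log k = (n * Real.log k) * ρ ^ 2 := by ring
    _ ≤ (n * Real.log k) * (((n : ℝ) * Real.log k)⁻¹ / C' ^ 2) :=
        mul_le_mul_of_nonneg_left h1 hy.le
    _ = 1 / C' ^ 2 := by field_simp

/-- Too little communication contradicts the bound on the success probabilities. -/
theorem numeric_contradiction {k ε x B Λ : ℝ} (hk : 2 ≤ k) (hε : 0 < ε) (hx : x = k / ε ^ 2)
    (hx1 : 100 ≤ x) (hlog : 4 ≤ Real.log x) (hεx : ε ^ 2 * Real.log x ≤ 1 / 10 ^ 6) (hB0 : 0 ≤ B)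
    (hB : B * (10 ^ 7 * ε ^ 2 * Real.log x) < k) (hΛ : Λ ≤ B + 1)
    (h : 2 * k / 3 ≤ 1 + 24 * (k * (B * (2 / x ^ 3)) +
      8 * ε ^ 2 * (64 * Real.log x) * (Λ + 3 * B)) + k / 12) : False := by
  have hx0 : 0 < x := by linarith
  have hkx : k = x * ε ^ 2 := by rw [hx]; field_simp
  -- A crude bound suffices because δ = 2/x³ is so small.
  have hBx : B ≤ x := by
    by_contra hcon
    push Not at hcon
    have h1 : x * ε ^ 2 ≤ B * ε ^ 2 := mul_le_mul_of_nonneg_right hcon.le (sq_nonneg _)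
    have h2 : B * ε ^ 2 * 1 ≤ B * ε ^ 2 * (10 ^ 7 * Real.log x) :=
      mul_le_mul_of_nonneg_left (by linarith) (by positivity)
    nlinarith
  have h1 : B * (2 / x ^ 3) ≤ 2 / 10000 := by
    calc B * (2 / x ^ 3) ≤ x * (2 / x ^ 3) := mul_le_mul_of_nonneg_right hBx (by positivity)
      _ = 2 / x ^ 2 := by field_simp
      _ ≤ 2 / 10000 := by
        refine div_le_div_of_nonneg_left (by norm_num) (by norm_num) ?_
        nlinarith
  have h2 : k * (B * (2 / x ^ 3)) ≤ k * (2 / 10000) :=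
    mul_le_mul_of_nonneg_left h1 (by linarith)
  have h3 : 8 * ε ^ 2 * (64 * Real.log x) * (Λ + 3 * B) ≤
      512 * (ε ^ 2 * Real.log x) * (4 * B + 1) := by
    have : 0 ≤ 512 * (ε ^ 2 * Real.log x) := by positivity
    have := mul_le_mul_of_nonneg_left (by linarith : Λ + 3 * B ≤ 4 * B + 1) this
    linarith
  have h4 : ε ^ 2 * Real.log x * B ≤ k / 10 ^ 7 := by
    rw [le_div_iff₀ (by norm_num)]; linarith
  have h5 : 512 * (ε ^ 2 * Real.log x) * (4 * B + 1) ≤ 2048 * (k / 10 ^ 7) + 512 / 10 ^ 6 := by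
    linarith
  -- The margin 2k/3 − 1 − k/12 is smallest at k = 2, where it is 1/6.
  norm_num at *
  linarith

theorem Protocol.communication_lower_bound {Ω R : Type*} [MeasurableSpace Ω] [MeasurableSpace R]
    {m n k : ℕ} (hn : 1 ≤ n) {ρ : ℝ} {μ₀ : Measure Ω} {μ : Fin k → Measure Ω}
    (h : IsCenteredFamily ρ μ₀ μ)
    (hρ : ρ ≤ ((n : ℝ) * Real.log k) ^ (-(1 / 2 : ℝ)) / 10 ^ 7) (hcorr : CorrCondition n ρ μ₀ μ)
    (π : Protocol m k (Fin n → Ω) R) (hπ : π.Identifies μ (1 / 3)) {B : ℕ}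
    (hB : ∀ r x t, (π.history r x t).length ≤ B) :
    (k : ℝ) / (10 ^ 7 * ρ ^ 2 * n * Real.log ((k : ℝ) / (n * ρ ^ 2))) ≤ B := by
  obtain ⟨F, hFm, hF, hFae, hμ⟩ := h.exists_density
  have := h.prob_center
  have := h.prob
  have hρ0 := h.rho_pos
  have hk2 : (2 : ℝ) ≤ k := by exact_mod_cast h.two_le
  have hn0 : (0 : ℝ) < n := by exact_mod_cast hn
  have hn1 : (1 : ℝ) ≤ n := by exact_mod_cast hn
  obtain ⟨ε, hεdef⟩ : ∃ ε, ε = √n * ρ := ⟨_, rfl⟩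
  have hε0 : 0 < ε := by rw [hεdef]; positivity
  have hε : (n : ℝ) * ρ ^ 2 = ε ^ 2 := by rw [hεdef, mul_pow, Real.sq_sqrt hn0.le]
  have hlogk := sample_size_bound hn hρ0 hk2 (by norm_num) hρ
  rw [hε] at hlogk
  obtain ⟨hε1, hεx⟩ := sq_mul_log_div_sq_le hk2 hε0 (by norm_num) hlogk
  obtain ⟨x, hx⟩ : ∃ x, x = (k : ℝ) / ε ^ 2 := ⟨_, rfl⟩
  have hρε : ρ ≤ ε := by
    rw [hεdef]
    exact le_mul_of_one_le_left hρ0.le (Real.one_le_sqrt.2 hn1)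
  have hεsq : ε ^ 2 ≤ 1 / 100 := by norm_num at hε1; nlinarith
  have hx1 : 100 ≤ x := by
    rw [hx, le_div_iff₀ (by positivity)]; linarith
  have hkx : (k : ℝ) = x * ε ^ 2 := by rw [hx]; field_simp
  have hx0 : 0 < x := by linarith
  have hlog : 4 ≤ Real.log x := by
    rw [Real.le_log_iff_exp_le hx0]
    calc Real.exp 4 = Real.exp 1 ^ 4 := by rw [← Real.exp_nat_mul]; norm_num
      _ ≤ 3 ^ 4 := pow_le_pow_left₀ (Real.exp_pos _).le (by linarith [Real.exp_one_lt_d9]) 4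
      _ ≤ x := by linarith
  rw [← hx] at hεx
  rw [hε, ← hx, mul_assoc (10 ^ 7 : ℝ), mul_comm (ρ ^ 2), hε]
  by_contra hcon
  push Not at hcon
  rw [lt_div_iff₀ (by positivity)] at hcon
  -- This makes the tail exp(−(L/2)²/2) equal to x^(−8), enough for δ = 2/x³ after a union bound
  -- over k ≤ x hypotheses.
  obtain ⟨L, hL⟩ : ∃ L, L = 8 * √(Real.log x) := ⟨_, rfl⟩
  have hL2 : L ^ 2 = 64 * Real.log x := by
    rw [hL, mul_pow, Real.sq_sqrt (by linarith)]; norm_num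
  have hL0 : 0 ≤ L := by rw [hL]; positivity
  have hL16 : 16 ≤ L := by nlinarith
  have hδsq : (2 / x ^ 3) ^ 2 = 4 / x ^ 6 := by field_simp; norm_num
  have hkx' : (k : ℝ) ≤ x := by rw [hkx]; nlinarith
  have hmain := π.sum_measureReal_output_le hB (fun i => Measure.pi fun _ : Fin n => μ i)
    (b := 1 + 24 * (k * (B * (2 / x ^ 3)) + 8 * ε ^ 2 * L ^ 2 *
      (((B : ℝ) + 1) + 3 * B)) + k / 12) (by positivity) (fun r _ out => by
      refine (sum_success_centered_le hn μ₀ μ (ρ := ρ) (ε := ε) (L := L) (δ := 2 / x ^ 3) F hFm hF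
        hμ hρ0 (by norm_num at hε1; linarith) hε0 hε (by norm_num at hε1; linarith) ?_ hL16 ?_
        (by positivity) ?_ ?_ ?_ (π.transcriptPartition hB r) out).trans ?_
      · have hF0 : ∀ i, ∫ a, F i a ∂μ₀ = 0 := fun i =>
          integral_eq_zero_of_withDensity μ₀ (μ i) (integrable_of_abs_le (hFm i) (hF i))
            (fun a => by have := abs_le.1 (hF i a); linarith [h.rho_lt_one]) (hμ i)
        rw [hεdef]
        exact hcorr.sum_le hn hρ0 μ₀ μ F hFae hF0
      · have : (ε * L) ^ 2 ≤ (1 / 4) ^ 2 := by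
          rw [mul_pow, hL2]; norm_num at hεx ⊢; linarith
        exact le_of_pow_le_pow_left₀ two_ne_zero (by norm_num) this
      · rw [div_le_iff₀ (by positivity)]
        nlinarith [pow_le_pow_left₀ (by norm_num : (0 : ℝ) ≤ 100) hx1 3]
      · rw [hδsq, hkx, mul_right_comm]
        refine mul_le_of_le_one_left (sq_nonneg _) ?_
        rw [mul_div_assoc', div_le_one (by positivity)]
        have : 4 ≤ x ^ 5 := by
          have := pow_le_pow_left₀ (by norm_num : (0 : ℝ) ≤ 100) hx1 5
          linarith
        calc x * 4 ≤ x * x ^ 5 := mul_le_mul_of_nonneg_left this hx0.le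
          _ = x ^ 6 := by ring
      · have e : Real.exp (-(L / 2) ^ 2 / 2) = (x ^ 8)⁻¹ := by
          have : -(L / 2) ^ 2 / 2 = -(((8 : ℕ) : ℝ) * Real.log x) := by
            push_cast; linear_combination (-1 / 8) * hL2
          rw [this, Real.exp_neg, Real.exp_nat_mul, Real.exp_log hx0]
        rw [e, hδsq]
        calc (k : ℝ) * (2 * (x ^ 8)⁻¹) ≤ x * (2 * (x ^ 8)⁻¹) := by gcongr
          _ = 2 / x ^ 6 / x := by field_simp
          _ ≤ 2 / x ^ 6 := div_le_self (by positivity) (by linarith)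
          _ = 4 / x ^ 6 / 2 := by ring
      · have hcard : Real.log (Fintype.card (Set.range fun x => π.history r x B)) ≤
            (B : ℝ) + 1 := by
          have h1 : Real.log (Fintype.card (Set.range fun x => π.history r x B)) ≤
              Real.log (2 ^ (B + 1)) := by
            rcases Nat.eq_zero_or_pos (Fintype.card (Set.range fun x => π.history r x B)) with
              h0 | h0
            · rw [h0]; simp
              positivity
            · refine Real.log_le_log (by exact_mod_cast h0) ?_
              exact_mod_cast π.card_range_history_le hB r
          rw [Real.log_pow] at h1
          push_cast at h1
          have : ((B : ℝ) + 1) * Real.log 2 ≤ ((B : ℝ) + 1) * 1 :=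
            mul_le_mul_of_nonneg_left (by linarith [Real.log_two_lt_d9]) (by positivity)
          linarith
        gcongr)
  have hsucc : 2 * (k : ℝ) / 3 ≤ ∑ i, (π.coins.prod (Measure.pi fun _ : Fin m =>
      Measure.pi fun _ : Fin n => μ i)).real {p | π.Outputs p.1 p.2 i} := by
    calc 2 * (k : ℝ) / 3 = ∑ _i : Fin k, (1 - 1 / 3 : ℝ) := by simp; ring
      _ ≤ _ := Finset.sum_le_sum fun i _ => hπ i
  have hfin := hsucc.trans hmain
  rw [hL2] at hfin
  exact numeric_contradiction hk2 hε0 hx hx1 hlog (by norm_num at hεx ⊢; linarith)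
    (Nat.cast_nonneg B) (by rw [mul_assoc (10 ^ 7 : ℝ)]; linarith) le_rfl hfin

theorem theorem1 :
    ∃ C C' : ℝ, 0 < C ∧ 0 < C' ∧
      ∀ (Ω : Type*) [MeasurableSpace Ω] (k : ℕ) (ρ : ℝ) (μ₀ : Measure Ω) (μ : Fin k → Measure Ω),
        IsCenteredFamily ρ μ₀ μ →
        ∀ n : ℕ, 1 ≤ n →
          (ρ ≤ ((n : ℝ) * Real.log k) ^ (-(1 / 2 : ℝ)) / C' →
            CorrCondition n ρ μ₀ μ →
            ∀ (m : ℕ), 1 ≤ m →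
              ∀ (R : Type*) [MeasurableSpace R] (π : Protocol m k (Fin n → Ω) R),
                π.Identifies μ (1 / 3) →
                ENNReal.ofReal
                    ((k : ℝ) / (C * ρ ^ 2 * n * Real.log ((k : ℝ) / (n * ρ ^ 2)))) ≤
                  (π.communicationComplexity : ℝ≥0∞)) ∧
          ((∃ ℓ : ℕ, 2 ≤ ℓ ∧
              (∀ S : Finset (Fin k), 2 ≤ S.card → S.card ≤ ℓ → corrTerm n ρ μ₀ μ S = 0) ∧
              (k : ℝ) ^ (2 * ((ℓ : ℝ) + 1) / ((ℓ : ℝ) - 1)) ≤ n) →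
            CorrCondition n ρ μ₀ μ) := by
  refine ⟨10 ^ 7, 10 ^ 7, by norm_num, by norm_num, ?_⟩
  intro Ω _ k ρ μ₀ μ h n hn
  refine ⟨fun hρ hcorr m _ R _ π hπ => ?_, fun ⟨ℓ, hℓ, hvan, hk⟩ =>
    corrCondition_of_vanishing hn h hℓ hvan hk⟩
  rcases eq_or_ne π.communicationComplexity ⊤ with htop | htop
  · rw [htop]; simp
  · obtain ⟨B, hBeq⟩ := ENat.ne_top_iff_exists.1 htop
    have hB : ∀ r x t, (π.history r x t).length ≤ B := fun r x t => by
      have h1 : ((π.history r x t).length : ℕ∞) ≤ π.communicationComplexity :=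
        le_iSup_of_le r (le_iSup_of_le x (le_iSup_of_le t le_rfl))
      rw [← hBeq] at h1
      exact_mod_cast h1
    rw [← hBeq]
    have := π.communication_lower_bound hn h hρ hcorr hπ hB
    calc _ ≤ ENNReal.ofReal (B : ℝ) := ENNReal.ofReal_le_ofReal this
      _ = _ := by simp
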